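/- Let $p\in\mathbb N$, let $A\in \mathrm{GL}(p,\mathbb Z)$ be hyperbolic (no complex eigenvalue of modulus $1$), let $b\in\mathbb R^p$, and let $\gamma(x)=Ax+b$ be the induced affine automorphism of $\mathbb T^p=\mathbb R^p/\mathbb Z^p$. Let $C^\infty(\mathbb T^p)$ be the space of complex-valued smooth functions on $\mathbb T^p$, with the topology of uniform convergence of all derivatives; it is a Fréchet space (locally convex, metrizable, complete). For $m\in\mathbb Z^p$ put $\Theta_m(x)=e^{2\pi i\langle x,m\rangle}$ and $\hat h(m)=\int_{\mathbb T^p}h(x)e^{-2\pi i\langle x,m\rangle}\,dx$, and let $\delta:C^\infty(\mathbb T^p)\to C^\infty(\mathbb T^p)$, $\delta(h)=h-h\circ\gamma$, be the coboundary operator. For every $m\in\mathbb Z^p\setminus\{0\}$ and $h\in C^\infty(\mathbb T^p)$ the series $$\Phi_m(h)=\sum_{k\in\mathbb Z}\widehat{h\circ\gamma^k}(m),\qquad \Phi_m^+(h)=\sum_{k\ge 0}\widehat{h\circ\gamma^k}(m)$$ converge absolutely and define continuous linear forms $\Phi_m,\Phi_m^+$ on $C^\infty(\mathbb T^p)$;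 put also $\Phi_0(h)=\int_{\mathbb T^p}h(x)\,dx$, which is a continuous linear form. All $\Phi_m$, $m\in\mathbb Z^p$, are $\gamma$-invariant: $\Phi_m(h\circ\gamma)=\Phi_m(h)$. Moreover: (i) The image $\mathrm{Im}(\delta)$ is closed in $C^\infty(\mathbb T^p)$ and equals $\bigcap_{m\in\mathbb Z^p}\ker\Phi_m$. The cohomology space $H^1(\gamma,C^\infty(\mathbb T^p)):=C^\infty(\mathbb T^p)/\mathrm{Im}(\delta)$, with the quotient topology, is a Fréchet space, and it is non-zero. (ii) There is a continuous linear operator $L:\mathrm{Im}(\delta)\to C^\infty(\mathbb T^p)$, where $\mathrm{Im}(\delta)$ carries the subspace topology, such that $\delta(L(g))=g$ for all $g\in\mathrm{Im}(\delta)$, given explicitly by $$L(g)=\sum_{m\in\mathbb Z^p\setminus\{0\}}\Phi_m^+(g)\,\Theta_m,$$ the series converging unconditionally in $C^\infty(\mathbb T^p)$. -/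

import Mathlib

open MeasureTheory UnitAddTorus
open scoped ContDiff

/-- An integer matrix `A ∈ GL(p, ℤ)` is hyperbolic if, as a complex matrix, it has no eigenvalue
of modulus `1`. -/
def IsHyperbolic {p : ℕ} (A : Matrix.GeneralLinearGroup (Fin p) ℤ) : Prop :=
  ∀ μ : ℂ, Module.End.HasEigenvalue
    (Matrix.toLin' ((A : Matrix (Fin p) (Fin p) ℤ).map (Int.cast : ℤ → ℂ))) μ → ‖μ‖ ≠ 1

/-- The canonical projection `ℝᵖ → 𝕋ᵖ = ℝᵖ / ℤᵖ`. -/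
def torusProj (p : ℕ) (x : Fin p → ℝ) : UnitAddTorus (Fin p) := fun i => (x i : UnitAddCircle)

/-- The action of an integer matrix on the torus `𝕋ᵖ`. -/
def torusMulVec {p : ℕ} (M : Matrix (Fin p) (Fin p) ℤ) (x : UnitAddTorus (Fin p)) :
    UnitAddTorus (Fin p) :=
  fun i => ∑ j, M i j • x j

theorem torusMulVec_mul {p : ℕ} (M N : Matrix (Fin p) (Fin p) ℤ) (x : UnitAddTorus (Fin p)) :
    torusMulVec (M * N) x = torusMulVec M (torusMulVec N x) := by
  funext i
  simp only [torusMulVec, Matrix.mul_apply, Finset.sum_smul, Finset.smul_sum, mul_smul]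
  exact Finset.sum_comm

theorem torusMulVec_one {p : ℕ} (x : UnitAddTorus (Fin p)) :
    torusMulVec (1 : Matrix (Fin p) (Fin p) ℤ) x = x := by
  funext i
  simp [torusMulVec, Matrix.one_apply, ite_smul]

/-- The affine automorphism `γ` of `𝕋ᵖ` induced by `x ↦ A x + b`, as a permutation of `𝕋ᵖ`
(so that `γ ^ k` makes sense for `k : ℤ`). -/
def torusAffine {p : ℕ} (A : Matrix.GeneralLinearGroup (Fin p) ℤ) (b : Fin p → ℝ) :
    Equiv.Perm (UnitAddTorus (Fin p)) where
  toFun x := torusMulVec (A : Matrix (Fin p) (Fin p) ℤ) x + torusProj p b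
  invFun y := torusMulVec ((A⁻¹ : Matrix.GeneralLinearGroup (Fin p) ℤ) :
    Matrix (Fin p) (Fin p) ℤ) (y - torusProj p b)
  left_inv x := by
    beta_reduce
    rw [add_sub_cancel_right, ← torusMulVec_mul, Units.inv_mul, torusMulVec_one]
  right_inv y := by
    beta_reduce
    rw [← torusMulVec_mul, Units.mul_inv, torusMulVec_one, sub_add_cancel]

/-- `γ` is induced by the affine map `x ↦ A x + b` of `ℝᵖ`. -/
theorem torusAffine_torusProj {p : ℕ} (A : Matrix.GeneralLinearGroup (Fin p) ℤ) (b : Fin p → ℝ)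
    (x : Fin p → ℝ) :
    torusAffine A b (torusProj p x) = torusProj p
      (((A : Matrix (Fin p) (Fin p) ℤ).map (Int.cast : ℤ → ℝ)).mulVec x + b) := by
  funext i
  have h : ∀ s : Finset (Fin p), ∀ f : Fin p → ℝ,
      ((∑ j ∈ s, f j : ℝ) : UnitAddCircle) = ∑ j ∈ s, (f j : UnitAddCircle) := fun s f =>
    map_sum (QuotientAddGroup.mk' (AddSubgroup.zmultiples (1 : ℝ))) f s
  simp only [torusAffine, Equiv.coe_fn_mk, torusMulVec, torusProj, Pi.add_apply, Matrix.mulVec,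
    dotProduct, Matrix.map_apply, AddCircle.coe_add, h]
  congr 1
  refine Finset.sum_congr rfl fun j _ => ?_
  rw [← AddCircle.coe_zsmul, zsmul_eq_mul]

/-- The complex functions of class `C^∞` on `𝕋ᵖ`, that is, those whose lift to `ℝᵖ` is smooth. -/
def smoothTorusSubmodule (p : ℕ) : Submodule ℂ (UnitAddTorus (Fin p) → ℂ) where
  carrier := {h | ContDiff ℝ ∞ (h ∘ torusProj p)}
  add_mem' {f g} hf hg := by
    rw [Set.mem_ofPred_eq] at *
    exact hf.add hg
  zero_mem' := by
    rw [Set.mem_ofPred_eq]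
    exact contDiff_const (c := (0 : ℂ))
  smul_mem' c f hf := by
    rw [Set.mem_ofPred_eq] at *
    exact hf.const_smul c

/-- The space `C^∞(𝕋ᵖ)`. -/
def SmoothTorus (p : ℕ) : Type := smoothTorusSubmodule p

namespace SmoothTorus

noncomputable instance (p : ℕ) : AddCommGroup (SmoothTorus p) :=
  inferInstanceAs (AddCommGroup (smoothTorusSubmodule p))

noncomputable instance (p : ℕ) : Module ℂ (SmoothTorus p) :=
  inferInstanceAs (Module ℂ (smoothTorusSubmodule p))

instance (p : ℕ) : FunLike (SmoothTorus p) (UnitAddTorus (Fin p)) ℂ where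
  coe h := h.1
  coe_injective _ _ e := Subtype.ext e

theorem contDiff {p : ℕ} (h : SmoothTorus p) : ContDiff ℝ ∞ (h ∘ torusProj p) := h.2

/-- The `n`-th derivative of (the lift to `ℝᵖ` of) `h ∈ C^∞(𝕋ᵖ)`, as a continuous map. -/
noncomputable def iteratedDerivMap {p : ℕ} (n : ℕ) (h : SmoothTorus p) :
    C(Fin p → ℝ, (Fin p → ℝ) [×n]→L[ℝ] ℂ) :=
  ⟨iteratedFDeriv ℝ n (h ∘ torusProj p),
    h.contDiff.continuous_iteratedFDeriv (by exact_mod_cast le_top)⟩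

/-- The `C^∞` topology: uniform convergence of all derivatives on compact sets. -/
noncomputable instance (p : ℕ) : TopologicalSpace (SmoothTorus p) :=
  ⨅ n : ℕ, TopologicalSpace.induced (iteratedDerivMap n) ContinuousMap.compactOpen

/-- The composition operator `h ↦ h ∘ γ` on `C^∞(𝕋ᵖ)`. -/
noncomputable def compAffine {p : ℕ} (A : Matrix.GeneralLinearGroup (Fin p) ℤ) (b : Fin p → ℝ) :
    SmoothTorus p →ₗ[ℂ] SmoothTorus p where
  toFun h := ⟨h ∘ torusAffine A b, by
    have e : (h ∘ torusAffine A b) ∘ torusProj p = (h ∘ torusProj p) ∘ fun x =>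
        ((A : Matrix (Fin p) (Fin p) ℤ).map (Int.cast : ℤ → ℝ)).mulVec x + b := by
      funext x
      simp only [Function.comp_apply, torusAffine_torusProj]
    change ContDiff ℝ ∞ ((h ∘ torusAffine A b) ∘ torusProj p)
    rw [e]
    refine h.contDiff.comp (ContDiff.add ?_ contDiff_const)
    exact (LinearMap.toContinuousLinearMap (Matrix.mulVecLin
      ((A : Matrix (Fin p) (Fin p) ℤ).map (Int.cast : ℤ → ℝ)))).contDiff⟩
  map_add' _ _ := rfl
  map_smul' _ _ := rfl

/-- The coboundary operator `δ(h) = h - h ∘ γ` on `C^∞(𝕋ᵖ)`. -/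
noncomputable def coboundary {p : ℕ} (A : Matrix.GeneralLinearGroup (Fin p) ℤ) (b : Fin p → ℝ) :
    SmoothTorus p →ₗ[ℂ] SmoothTorus p :=
  LinearMap.id - compAffine A b

theorem compAffine_apply {p : ℕ} (A : Matrix.GeneralLinearGroup (Fin p) ℤ) (b : Fin p → ℝ)
    (h : SmoothTorus p) (x : UnitAddTorus (Fin p)) :
    compAffine A b h x = h (torusAffine A b x) := rfl

theorem coboundary_apply {p : ℕ} (A : Matrix.GeneralLinearGroup (Fin p) ℤ) (b : Fin p → ℝ)
    (h : SmoothTorus p) (x : UnitAddTorus (Fin p)) :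
    coboundary A b h x = h x - h (torusAffine A b x) := rfl

/-- The cohomology space `H¹(γ, C^∞(𝕋ᵖ)) = C^∞(𝕋ᵖ) / Im δ`, with the quotient topology. -/
abbrev H1 {p : ℕ} (A : Matrix.GeneralLinearGroup (Fin p) ℤ) (b : Fin p → ℝ) : Type :=
  SmoothTorus p ⧸ LinearMap.range (coboundary A b)

/-- The character `Θ_m(x) = exp (2 π i ⟨x, m⟩)`, as an element of `C^∞(𝕋ᵖ)`. -/
noncomputable def character {p : ℕ} (m : Fin p → ℤ) : SmoothTorus p :=
  ⟨mFourier m, by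
    have e : (mFourier m : UnitAddTorus (Fin p) → ℂ) ∘ torusProj p = fun x =>
        ∏ i, Complex.exp (2 * Real.pi * Complex.I * m i * (x i : ℂ) / (1 : ℝ)) := by
      funext x
      simp only [Function.comp_apply, mFourier, ContinuousMap.coe_mk, torusProj,
        fourier_coe_apply]
    change ContDiff ℝ ∞ ((mFourier m : UnitAddTorus (Fin p) → ℂ) ∘ torusProj p)
    rw [e]
    refine contDiff_prod fun i _ => ContDiff.cexp (ContDiff.div_const (ContDiff.mul
      contDiff_const ?_) _)
    exact Complex.ofRealCLM.contDiff.comp (contDiff_apply ℝ ℝ i)⟩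

end SmoothTorus

/-- A Fréchet space: a complex topological vector space which is locally convex, metrizable and
complete (for the uniform structure of its additive group). -/
structure IsFrechetSpace (E : Type*) [AddCommGroup E] [Module ℂ E] [TopologicalSpace E] :
    Prop where
  isTopologicalAddGroup : IsTopologicalAddGroup E
  continuousSMul : ContinuousSMul ℂ E
  locallyConvexSpace : LocallyConvexSpace ℝ E
  metrizableSpace : TopologicalSpace.MetrizableSpace E
  completeSpace : @CompleteSpace E (IsTopologicalAddGroup.rightUniformSpace E)

/-! Write σ = (A⁻¹)ᵀ acting on ℤᵖ (`dualPerm`). Up to a phase of modulus one, the coefficient of h ∘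
γᵏ at m is ĥ(σᵏm), so H − H ∘ γ = g becomes a recursion along σ-orbits. Splitting the characteristic
polynomial of Aᵀ into roots inside and outside the unit circle gives m = Pm + Qm, where ‖Pm‖ bounds
the growth of σⁿm from below and ‖Qm‖ that of σ⁻ⁿm (`exists_dualPerm_splitting`). For m ≠ 0 neither
part vanishes, because a nonzero lattice vector has norm at least 1 and cannot be contracted to 0.
Rapid decay of ĥ then makes all orbit sums converge absolutely (`exists_norm_orbitCoeff_le`).

By telescoping, Ĥ(m) = Φ_m⁺(g) for m ≠ 0 solves the equation formally (`coboundary_eq_of_coeff`);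
the issue is smoothness of H. If Pm is short compared with m, the forward orbit gives a poor bound.
When Φ_m(g) = 0, however, Φ_m⁺(g) is also minus the sum over the backward orbit. One of ‖Pm‖, ‖Qm‖
is at least ‖m‖/2, and summing in the corresponding direction bounds Φ_m⁺(g) by any negative power
of ‖m‖ times a seminorm of g (`exists_freqWeight_pow_mul_norm_le`). This yields both smoothness of H
and continuity of L.

For the topology, weighted Fourier coefficients identify C^∞(𝕋ᵖ) with a closed subspace of a
countable product of ℓ^∞ spaces (`isInducing_allWeightedCoeff`, `isClosed_range_allWeightedCoeff`).
-/

section Hyperbolic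

-- Hyperbolic linear algebra, with the operator norm belonging to the sup norm.

attribute [local instance] Matrix.linftyOpNormedRing Matrix.linftyOpNormedAlgebra

/-- A sequence subject to `a (n + 1) ≤ r a n + K ρ ^ n` with `r, ρ < 1` decays exponentially. -/
theorem exists_le_mul_pow_of_succ_le {a : ℕ → ℝ} {r K ρ : ℝ} (ha : ∀ n, 0 ≤ a n) (hr0 : 0 ≤ r)
    (hr : r < 1) (hK : 0 ≤ K) (hρ0 : 0 < ρ) (hρ : ρ < 1)
    (h : ∀ n, a (n + 1) ≤ r * a n + K * ρ ^ n) :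
    ∃ C σ : ℝ, 0 ≤ C ∧ 0 < σ ∧ σ < 1 ∧ ∀ n, a n ≤ C * σ ^ n := by
  obtain ⟨σ, hσ, hσ1⟩ := exists_between (max_lt hr hρ)
  have hrσ : r < σ := (le_max_left _ _).trans_lt hσ
  have hρσ : ρ < σ := (le_max_right _ _).trans_lt hσ
  have hd : 0 < σ - r := sub_pos.2 hrσ
  have hC : 0 ≤ a 0 + K / (σ - r) := add_nonneg (ha 0) (div_nonneg hK hd.le)
  refine ⟨a 0 + K / (σ - r), σ, hC, hρ0.trans hρσ, hσ1, fun n => ?_⟩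
  induction n with
  | zero => simpa using div_nonneg hK hd.le
  | succ n ih =>
    have hKC : K ≤ (a 0 + K / (σ - r)) * (σ - r) := by
      rw [add_mul, div_mul_cancel₀ _ hd.ne']
      exact le_add_of_nonneg_left (mul_nonneg (ha 0) hd.le)
    have hσn : 0 ≤ σ ^ n := pow_nonneg (hρ0.trans hρσ).le n
    calc a (n + 1) ≤ r * a n + K * ρ ^ n := h n
      _ ≤ r * ((a 0 + K / (σ - r)) * σ ^ n) + (a 0 + K / (σ - r)) * (σ - r) * σ ^ n := by
        gcongr
      _ = _ := by ring

section Algebra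

open Polynomial

variable {R : Type*} [NormedRing R] [NormedAlgebra ℂ R]

theorem norm_algebraMap_mul_le (c : ℂ) (x : R) : ‖algebraMap ℂ R c * x‖ ≤ ‖c‖ * ‖x‖ := by
  rw [← Algebra.smul_def]
  exact norm_smul_le _ _

/-- If `t` is annihilated by a polynomial in `b` all of whose roots lie in the open unit disc, then
`b ^ n * t` decays exponentially. -/
theorem exists_norm_pow_mul_le (b : R) (s : Multiset ℂ) (hs : ∀ μ ∈ s, ‖μ‖ < 1) (t : R)
    (ht : aeval b (s.map fun μ => X - C μ).prod * t = 0) :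
    ∃ K ρ : ℝ, 0 ≤ K ∧ 0 < ρ ∧ ρ < 1 ∧ ∀ n : ℕ, ‖b ^ n * t‖ ≤ K * ρ ^ n := by
  induction s using Multiset.induction_on generalizing t with
  | empty => exact ⟨0, 1 / 2, le_rfl, by norm_num, by norm_num, by simp_all⟩
  | cons μ s ih =>
    obtain ⟨K, ρ, hK, hρ0, hρ, h⟩ := ih (fun ν hν => hs ν (Multiset.mem_cons_of_mem hν))
      ((b - algebraMap ℂ R μ) * t) (by
        rw [Multiset.map_cons, Multiset.prod_cons, mul_comm, map_mul, mul_assoc] at ht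
        simpa using ht)
    refine exists_le_mul_pow_of_succ_le (fun n => norm_nonneg _) (norm_nonneg μ)
      (hs μ (Multiset.mem_cons_self _ _)) hK hρ0 hρ fun n => ?_
    -- Write b = μ + (b − μ): the second summand has lost the root μ and falls under the induction
    -- hypothesis.
    have e : b ^ (n + 1) * t
        = algebraMap ℂ R μ * (b ^ n * t) + b ^ n * ((b - algebraMap ℂ R μ) * t) := by
      rw [← mul_assoc, Algebra.commutes μ (b ^ n), pow_succ]
      noncomm_ring
    rw [e]
    exact (norm_add_le _ _).trans (add_le_add (norm_algebraMap_mul_le _ _) (h n))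

/-- If `t` is annihilated by a polynomial in `b` all of whose roots lie outside the closed unit
disc, then `b⁻¹ ^ n * t` decays exponentially. -/
theorem exists_norm_inv_pow_mul_le {b b' : R} (hb : b' * b = 1) (s : Multiset ℂ)
    (hs : ∀ μ ∈ s, 1 < ‖μ‖) (t : R) (ht : aeval b (s.map fun μ => X - C μ).prod * t = 0) :
    ∃ K ρ : ℝ, 0 ≤ K ∧ 0 < ρ ∧ ρ < 1 ∧ ∀ n : ℕ, ‖b' ^ n * t‖ ≤ K * ρ ^ n := by
  induction s using Multiset.induction_on generalizing t with
  | empty => exact ⟨0, 1 / 2, le_rfl, by norm_num, by norm_num, by simp_all⟩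
  | cons μ s ih =>
    obtain ⟨K, ρ, hK, hρ0, hρ, h⟩ := ih (fun ν hν => hs ν (Multiset.mem_cons_of_mem hν))
      ((b - algebraMap ℂ R μ) * t) (by
        rw [Multiset.map_cons, Multiset.prod_cons, mul_comm, map_mul, mul_assoc] at ht
        simpa using ht)
    have hμ := hs μ (Multiset.mem_cons_self _ _)
    have hμ0 : μ ≠ 0 := norm_pos_iff.1 (one_pos.trans hμ)
    have hμi : ‖μ⁻¹‖ < 1 := by rw [norm_inv]; exact inv_lt_one_of_one_lt₀ hμ
    refine exists_le_mul_pow_of_succ_le (fun n => norm_nonneg _) (norm_nonneg μ⁻¹)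
      hμi hK hρ0 hρ fun n => ?_
    have e1 : b' ^ (n + 1) * ((b - algebraMap ℂ R μ) * t)
        = b' ^ n * t - algebraMap ℂ R μ * (b' ^ (n + 1) * t) := by
      rw [← mul_assoc (algebraMap ℂ R μ), Algebra.commutes μ (b' ^ (n + 1)), sub_mul, mul_sub,
        ← mul_assoc _ b, pow_succ, mul_assoc _ b' b, hb]
      noncomm_ring
    -- Solving e1 for the higher power makes |μ⁻¹| < 1 the contraction factor.
    have e2 : b' ^ (n + 1) * t = algebraMap ℂ R μ⁻¹ *
        (b' ^ n * t - b' ^ (n + 1) * ((b - algebraMap ℂ R μ) * t)) := by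
      rw [e1, sub_sub_cancel, ← mul_assoc, ← map_mul, inv_mul_cancel₀ hμ0, map_one, one_mul]
    have h1 : ‖b' ^ (n + 1) * ((b - algebraMap ℂ R μ) * t)‖ ≤ K * ρ ^ n :=
      (h (n + 1)).trans (mul_le_mul_of_nonneg_left
        (pow_le_pow_of_le_one hρ0.le hρ.le n.le_succ) hK)
    rw [e2]
    refine (norm_algebraMap_mul_le _ _).trans ?_
    calc ‖μ⁻¹‖ * ‖b' ^ n * t - b' ^ (n + 1) * ((b - algebraMap ℂ R μ) * t)‖
        ≤ ‖μ⁻¹‖ * (‖b' ^ n * t‖ + K * ρ ^ n) := by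
          gcongr
          exact (norm_sub_le _ _).trans (add_le_add le_rfl h1)
      _ ≤ ‖μ⁻¹‖ * ‖b' ^ n * t‖ + 1 * (K * ρ ^ n) := by
          rw [mul_add]
          gcongr
      _ = _ := by rw [one_mul]

end Algebra

section Splitting

open Polynomial

/-- A hyperbolic invertible complex matrix decomposes the identity into a sum of a matrix which is
contracted in the future and a matrix which is contracted in the past. -/
theorem Matrix.exists_hyperbolic_splitting {ι : Type*} [Fintype ι] [DecidableEq ι]
    {b b' : Matrix ι ι ℂ} (hb : b' * b = 1) (h : ∀ μ, b.charpoly.IsRoot μ → ‖μ‖ ≠ 1) :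
    ∃ P Q : Matrix ι ι ℂ, ∃ K ρ : ℝ, P + Q = 1 ∧ Commute b P ∧ Commute b Q ∧ 0 < K ∧ 0 < ρ ∧
      ρ < 1 ∧ (∀ n : ℕ, ‖b ^ n * P‖ ≤ K * ρ ^ n) ∧ ∀ n : ℕ, ‖b' ^ n * Q‖ ≤ K * ρ ^ n := by
  classical
  set s := b.charpoly.roots.filter fun μ => ‖μ‖ < 1
  set t := b.charpoly.roots.filter fun μ => ¬ ‖μ‖ < 1
  have hs : ∀ μ ∈ s, ‖μ‖ < 1 := fun μ hμ => (Multiset.mem_filter.1 hμ).2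
  have ht : ∀ μ ∈ t, 1 < ‖μ‖ := fun μ hμ =>
    lt_of_le_of_ne (not_lt.1 (Multiset.mem_filter.1 hμ).2)
      (h μ (isRoot_of_mem_roots (Multiset.mem_filter.1 hμ).1)).symm
  set f : ℂ[X] := (s.map fun μ => X - C μ).prod
  set g : ℂ[X] := (t.map fun μ => X - C μ).prod
  have hfg : f * g = b.charpoly := by
    rw [← Multiset.prod_add, ← Multiset.map_add, Multiset.filter_add_not]
    exact ((IsAlgClosed.splits _).eq_prod_roots_of_monic b.charpoly_monic).symm
  have hcop : IsCoprime f g := by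
    rw [isCoprime_iff_aeval_ne_zero_of_isAlgClosed ℂ ℂ]
    intro z
    by_contra! hz
    have aux : ∀ r : Multiset ℂ, aeval z (r.map fun μ => X - C μ).prod = 0 → z ∈ r := by
      intro r hr
      rw [map_multiset_prod, Multiset.prod_eq_zero_iff] at hr
      simpa [sub_eq_zero] using hr
    exact lt_asymm (hs z (aux s hz.1)) (ht z (aux t hz.2))
  -- In the Bézout identity uf + vg = 1, take P = (vg)(b) and Q = (uf)(b). By Cayley–Hamilton f(b)
  -- kills P and g(b) kills Q.
  obtain ⟨u, v, huv⟩ := hcop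
  have hcomm : ∀ q : ℂ[X], Commute b (aeval b q) := fun q => by
    rw [Commute, SemiconjBy]
    nth_rw 1 4 [← aeval_X (R := ℂ) b]
    rw [← map_mul, ← map_mul, mul_comm]
  have hann : aeval b (f * g) = 0 := by rw [hfg, Matrix.aeval_self_charpoly]
  obtain ⟨K₁, ρ₁, hK₁, hρ₁0, hρ₁, h₁⟩ := exists_norm_pow_mul_le b s hs (aeval b (v * g)) (by
    rw [← map_mul, show f * (v * g) = v * (f * g) by ring, map_mul, hann, mul_zero])
  obtain ⟨K₂, ρ₂, hK₂, hρ₂0, hρ₂, h₂⟩ := exists_norm_inv_pow_mul_le hb t ht (aeval b (u * f)) (by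
    rw [← map_mul, show g * (u * f) = u * (f * g) by ring, map_mul, hann, mul_zero])
  refine ⟨aeval b (v * g), aeval b (u * f), K₁ + K₂ + 1, max ρ₁ ρ₂, ?_, hcomm _, hcomm _,
    by positivity, lt_max_of_lt_left hρ₁0, max_lt hρ₁ hρ₂, fun n => (h₁ n).trans ?_,
    fun n => (h₂ n).trans ?_⟩
  · rw [← map_add, add_comm, huv, map_one]
  · gcongr
    · linarith
    · exact le_max_left _ _
  · gcongr
    · linarith
    · exact le_max_right _ _

/-- The action `m ↦ (A⁻¹)ᵀ m` on the dual lattice `ℤᵖ`. -/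
def dualPerm {p : ℕ} (A : Matrix.GeneralLinearGroup (Fin p) ℤ) : Equiv.Perm (Fin p → ℤ) where
  toFun m := ((A⁻¹ : Matrix.GeneralLinearGroup (Fin p) ℤ) :
    Matrix (Fin p) (Fin p) ℤ).transpose.mulVec m
  invFun m := (A : Matrix (Fin p) (Fin p) ℤ).transpose.mulVec m
  left_inv m := by
    beta_reduce
    rw [Matrix.mulVec_mulVec, ← Matrix.transpose_mul, Units.inv_mul, Matrix.transpose_one,
      Matrix.one_mulVec]
  right_inv m := by
    beta_reduce
    rw [Matrix.mulVec_mulVec, ← Matrix.transpose_mul, Units.mul_inv, Matrix.transpose_one,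
      Matrix.one_mulVec]

variable {p : ℕ} (A : Matrix.GeneralLinearGroup (Fin p) ℤ)

theorem dualPerm_pow_apply (n : ℕ) (m : Fin p → ℤ) : (dualPerm A ^ n) m =
    (((A⁻¹ : Matrix.GeneralLinearGroup (Fin p) ℤ) :
      Matrix (Fin p) (Fin p) ℤ).transpose ^ n).mulVec m := by
  induction n generalizing m with
  | zero => simp
  | succ n ih => rw [pow_succ, Equiv.Perm.mul_apply, ih, pow_succ, ← Matrix.mulVec_mulVec]; rfl

theorem dualPerm_inv_pow_apply (n : ℕ) (m : Fin p → ℤ) : ((dualPerm A)⁻¹ ^ n) m =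
    ((A : Matrix (Fin p) (Fin p) ℤ).transpose ^ n).mulVec m := by
  induction n generalizing m with
  | zero => simp
  | succ n ih => rw [pow_succ, Equiv.Perm.mul_apply, ih, pow_succ, ← Matrix.mulVec_mulVec]; rfl

theorem dualPerm_zpow_zero (k : ℤ) : (dualPerm A ^ k) 0 = 0 := by
  cases k with
  | ofNat n => simp [dualPerm_pow_apply]
  | negSucc n => rw [zpow_negSucc, ← inv_pow, dualPerm_inv_pow_apply, Matrix.mulVec_zero]

theorem dualPerm_zpow_ne_zero (k : ℤ) {m : Fin p → ℤ} (hm : m ≠ 0) : (dualPerm A ^ k) m ≠ 0 := by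
  rw [← dualPerm_zpow_zero A k]
  exact (dualPerm A ^ k).injective.ne hm

theorem norm_intCast_comp (m : Fin p → ℤ) : ‖fun i => (m i : ℂ)‖ = ‖m‖ := by
  have h : ∀ i, ‖(m i : ℂ)‖₊ = ‖m i‖₊ := fun i => NNReal.eq (by
    rw [coe_nnnorm, coe_nnnorm, Complex.norm_intCast, Int.norm_eq_abs])
  simp only [Pi.norm_def, h]

theorem one_le_norm_of_ne_zero {m : Fin p → ℤ} (hm : m ≠ 0) : 1 ≤ ‖m‖ := by
  obtain ⟨i, hi⟩ := Function.ne_iff.1 hm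
  refine le_trans ?_ (norm_le_pi_norm m i)
  rw [Int.norm_eq_abs]
  exact_mod_cast Int.one_le_abs hi

theorem intCast_mulVec (M : Matrix (Fin p) (Fin p) ℤ) (n : ℕ) (m : Fin p → ℤ) :
    (fun i => (((M ^ n).mulVec m i : ℤ) : ℂ)) =
      ((M.map (Int.cast : ℤ → ℂ)) ^ n).mulVec fun i => (m i : ℂ) := by
  have := RingHom.map_mulVec (Int.castRingHom ℂ) (M ^ n) m
  funext i
  rw [show M.map (Int.cast : ℤ → ℂ) = (Int.castRingHom ℂ).mapMatrix M from rfl, ← map_pow]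
  exact this i

/-- The stable and unstable parts of a frequency `m ∈ ℤᵖ` for a hyperbolic automorphism. -/
theorem exists_dualPerm_splitting (hA : IsHyperbolic A) :
    ∃ (s u : (Fin p → ℤ) → ℝ) (K ρ : ℝ), 0 < K ∧ 0 < ρ ∧ ρ < 1 ∧
      (∀ m, ‖m‖ ≤ s m + u m) ∧ (∀ m, m ≠ 0 → 0 < s m ∧ 0 < u m) ∧
      (∀ m (n : ℕ), s m ≤ K * ρ ^ n * ‖(dualPerm A ^ n) m‖) ∧
      ∀ m (n : ℕ), u m ≤ K * ρ ^ n * ‖((dualPerm A)⁻¹ ^ n) m‖ := by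
  set B : Matrix (Fin p) (Fin p) ℤ := (A : Matrix (Fin p) (Fin p) ℤ).transpose with hB
  set B' : Matrix (Fin p) (Fin p) ℤ :=
    ((A⁻¹ : Matrix.GeneralLinearGroup (Fin p) ℤ) : Matrix (Fin p) (Fin p) ℤ).transpose with hB'
  set b := (Int.castRingHom ℂ).mapMatrix B with hb
  set b' := (Int.castRingHom ℂ).mapMatrix B' with hb'
  have hbb : b' * b = 1 := by
    rw [hb, hb', ← map_mul, hB, hB', ← Matrix.transpose_mul, Units.mul_inv, Matrix.transpose_one,
      map_one]
  have hbb' : b * b' = 1 := mul_eq_one_comm.1 hbb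
  have hroot : ∀ μ, b.charpoly.IsRoot μ → ‖μ‖ ≠ 1 := by
    intro μ hμ
    refine hA μ ?_
    rw [Module.End.hasEigenvalue_iff_isRoot_charpoly, Matrix.charpoly_toLin',
      ← Matrix.charpoly_transpose]
    exact hμ
  obtain ⟨P, Q, K, ρ, hPQ, hP, hQ, hK, hρ0, hρ, hPn, hQn⟩ :=
    Matrix.exists_hyperbolic_splitting hbb hroot
  have hP' : Commute b' P := by
    have := congrArg (fun x => b' * x * b') hP.eq
    simp only [mul_assoc, hbb', mul_one] at this
    rw [← mul_assoc b' b, hbb, one_mul] at this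
    exact this.symm
  have hs : ∀ m (n : ℕ), ‖P.mulVec fun i => (m i : ℂ)‖ ≤ K * ρ ^ n * ‖(dualPerm A ^ n) m‖ := by
    intro m n
    -- Contraction by bⁿ on the range of P, read backwards, is expansion of the P-part under b'ⁿ,
    -- which is σⁿ.
    have e : P = b ^ n * P * b' ^ n := by
      rw [mul_assoc, ← (hP'.pow_left n).eq, ← mul_assoc, ← (Commute.mul_pow
        (show Commute b b' by rw [Commute, SemiconjBy, hbb, hbb'])), hbb', one_pow, one_mul]
    rw [dualPerm_pow_apply, ← norm_intCast_comp (Matrix.mulVec _ _), intCast_mulVec]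
    conv_lhs => rw [e, ← Matrix.mulVec_mulVec]
    exact (Matrix.linfty_opNorm_mulVec _ _).trans
      (mul_le_mul_of_nonneg_right (hPn n) (norm_nonneg _))
  have hu : ∀ m (n : ℕ), ‖Q.mulVec fun i => (m i : ℂ)‖
      ≤ K * ρ ^ n * ‖((dualPerm A)⁻¹ ^ n) m‖ := by
    intro m n
    have e : Q = b' ^ n * Q * b ^ n := by
      rw [mul_assoc, ← (hQ.pow_left n).eq, ← mul_assoc, ← (Commute.mul_pow
        (show Commute b' b by rw [Commute, SemiconjBy, hbb, hbb'])), hbb, one_pow, one_mul]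
    rw [dualPerm_inv_pow_apply, ← norm_intCast_comp (Matrix.mulVec _ _), intCast_mulVec]
    conv_lhs => rw [e, ← Matrix.mulVec_mulVec]
    exact (Matrix.linfty_opNorm_mulVec _ _).trans
      (mul_le_mul_of_nonneg_right (hQn n) (norm_nonneg _))
  have hadd : ∀ m : Fin p → ℤ, (fun i => (m i : ℂ)) =
      (P.mulVec fun i => (m i : ℂ)) + Q.mulVec fun i => (m i : ℂ) := fun m => by
    rw [← Matrix.add_mulVec, hPQ, Matrix.one_mulVec]
  have hsmall : ∀ m : Fin p → ℤ, ∃ n : ℕ, K * ρ ^ n * ‖m‖ < 1 := fun m => by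
    have : Filter.Tendsto (fun n : ℕ => K * ρ ^ n * ‖m‖) Filter.atTop (nhds (K * 0 * ‖m‖)) :=
      ((tendsto_pow_atTop_nhds_zero_of_lt_one hρ0.le hρ).const_mul K).mul_const _
    rw [mul_zero, zero_mul] at this
    exact (this.eventually (gt_mem_nhds one_pos)).exists
  refine ⟨fun m => ‖P.mulVec fun i => (m i : ℂ)‖, fun m => ‖Q.mulVec fun i => (m i : ℂ)‖, K, ρ,
    hK, hρ0, hρ, fun m => ?_, fun m hm => ⟨?_, ?_⟩, hs, hu⟩
  · rw [← norm_intCast_comp, hadd m]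
    exact norm_add_le _ _
  -- If Pm = 0 then m = Qm, so σⁿm tends to 0, although it is a nonzero integer vector for every n.
  · refine lt_of_le_of_ne (norm_nonneg _) fun h0 => ?_
    obtain ⟨n, hn⟩ := hsmall m
    refine (one_le_norm_of_ne_zero (dualPerm_zpow_ne_zero A n hm)).not_gt (lt_of_le_of_lt ?_ hn)
    rw [zpow_natCast, dualPerm_pow_apply, ← norm_intCast_comp (Matrix.mulVec _ _), intCast_mulVec,
      hadd m, norm_eq_zero.1 h0.symm, zero_add, Matrix.mulVec_mulVec, ← norm_intCast_comp m]
    exact (Matrix.linfty_opNorm_mulVec _ _).trans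
      (mul_le_mul_of_nonneg_right (hQn n) (norm_nonneg _))
  · refine lt_of_le_of_ne (norm_nonneg _) fun h0 => ?_
    obtain ⟨n, hn⟩ := hsmall m
    refine (one_le_norm_of_ne_zero (dualPerm_zpow_ne_zero A (-n) hm)).not_gt (lt_of_le_of_lt ?_ hn)
    rw [zpow_neg, zpow_natCast, ← inv_pow, dualPerm_inv_pow_apply,
      ← norm_intCast_comp (Matrix.mulVec _ _), intCast_mulVec, hadd m,
      norm_eq_zero.1 h0.symm, add_zero, Matrix.mulVec_mulVec, ← norm_intCast_comp m]
    exact (Matrix.linfty_opNorm_mulVec _ _).trans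
      (mul_le_mul_of_nonneg_right (hPn n) (norm_nonneg _))

end Splitting

end Hyperbolic

/-! ### Fourier coefficients on the torus and their behaviour under γ. -/

theorem UnitAddTorus.volume_eq_pi_haarAddCircle {ι : Type*} [Fintype ι] :
    (volume : Measure (UnitAddTorus ι)) = Measure.pi fun _ => AddCircle.haarAddCircle := by
  rw [volume_pi]
  congr 1
  funext i
  rw [AddCircle.volume_eq_smul_haarAddCircle, ENNReal.ofReal_one, one_smul]

instance {ι : Type*} [Fintype ι] : IsProbabilityMeasure (volume : Measure (UnitAddTorus ι)) := by
  rw [UnitAddTorus.volume_eq_pi_haarAddCircle]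
  infer_instance

/-- `mFourierCoeff` is built on normalised Haar measure; the circle has length 1, so this is
`volume`, for which the invariance arguments below are phrased. -/
theorem mFourierCoeff_eq_integral_volume {ι : Type*} [Fintype ι] (f : UnitAddTorus ι → ℂ)
    (n : ι → ℤ) : mFourierCoeff f n = ∫ t, mFourier (-n) t * f t := by
  rw [UnitAddTorus.volume_eq_pi_haarAddCircle]
  rfl

section Torus

variable {p : ℕ}

theorem mFourierCoeff_zero_eq_integral (f : UnitAddTorus (Fin p) → ℂ) :
    mFourierCoeff f 0 = ∫ t, f t := by
  simp [mFourierCoeff_eq_integral_volume, mFourier_zero]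

theorem norm_mFourier_apply (n : Fin p → ℤ) (x : UnitAddTorus (Fin p)) : ‖mFourier n x‖ = 1 := by
  simp only [mFourier, fourier_apply, ContinuousMap.coe_mk, norm_prod, Circle.norm_coe,
    Finset.prod_const_one]

theorem mFourier_apply_add (n : Fin p → ℤ) (x y : UnitAddTorus (Fin p)) :
    mFourier n (x + y) = mFourier n x * mFourier n y := by
  simp only [mFourier, ContinuousMap.coe_mk, Pi.add_apply, ← Finset.prod_mul_distrib]
  refine Finset.prod_congr rfl fun i _ => ?_
  simp [fourier_apply, AddCircle.toCircle_add]

theorem mFourier_neg_mul_self (n : Fin p → ℤ) (x : UnitAddTorus (Fin p)) :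
    mFourier n x * mFourier (-n) x = 1 := by
  rw [← mFourier_add, add_neg_cancel, mFourier_zero, ContinuousMap.one_apply]

theorem fourier_sum_zsmul {ι : Type*} (s : Finset ι) (n : ℤ) (c : ι → ℤ) (x : ι → UnitAddCircle) :
    fourier n (∑ j ∈ s, c j • x j) = ∏ j ∈ s, fourier (c j * n) (x j) := by
  classical
  induction s using Finset.induction_on with
  | empty => simp
  | insert a s ha ih =>
    rw [Finset.sum_insert ha, Finset.prod_insert ha, ← ih]
    simp [fourier_apply, AddCircle.toCircle_add, mul_comm (c a), mul_smul]

theorem fourier_sum_left {ι : Type*} (s : Finset ι) (n : ι → ℤ) (x : UnitAddCircle) :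
    fourier (∑ j ∈ s, n j) x = ∏ j ∈ s, fourier (n j) x := by
  classical
  induction s using Finset.induction_on with
  | empty => simp
  | insert a s ha ih => rw [Finset.sum_insert ha, Finset.prod_insert ha, ← ih, fourier_add]

theorem mFourier_torusMulVec (M : Matrix (Fin p) (Fin p) ℤ) (n : Fin p → ℤ)
    (x : UnitAddTorus (Fin p)) :
    mFourier n (torusMulVec M x) = mFourier (M.transpose.mulVec n) x := by
  simp only [mFourier, ContinuousMap.coe_mk, torusMulVec, fourier_sum_zsmul, Matrix.mulVec,
    dotProduct, Matrix.transpose_apply, fourier_sum_left]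
  exact Finset.prod_comm

theorem norm_mFourierCoeff_le {f : UnitAddTorus (Fin p) → ℂ} {C : ℝ} (h : ∀ x, ‖f x‖ ≤ C)
    (n : Fin p → ℤ) : ‖mFourierCoeff f n‖ ≤ C := by
  rw [mFourierCoeff_eq_integral_volume]
  refine (norm_integral_le_of_norm_le_const (C := C) (Filter.Eventually.of_forall fun x => ?_)).trans
    (by rw [probReal_univ, mul_one])
  rw [norm_mul, norm_mFourier_apply, one_mul]
  exact h x

theorem integrable_mFourier_mul {f : UnitAddTorus (Fin p) → ℂ} (hf : Continuous f)
    (n : Fin p → ℤ) : Integrable fun x => mFourier n x * f x := by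
  have : Continuous fun x => mFourier n x * f x := (mFourier n).continuous.mul hf
  exact this.integrable_of_hasCompactSupport (HasCompactSupport.of_compactSpace _)

theorem mFourierCoeff_add {f g : UnitAddTorus (Fin p) → ℂ} (hf : Continuous f) (hg : Continuous g)
    (n : Fin p → ℤ) : mFourierCoeff (f + g) n = mFourierCoeff f n + mFourierCoeff g n := by
  simp only [mFourierCoeff_eq_integral_volume, Pi.add_apply, mul_add]
  exact integral_add (integrable_mFourier_mul hf _) (integrable_mFourier_mul hg _)

theorem mFourierCoeff_smul (c : ℂ) (f : UnitAddTorus (Fin p) → ℂ) (n : Fin p → ℤ) :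
    mFourierCoeff (c • f) n = c * mFourierCoeff f n := by
  simp only [mFourierCoeff_eq_integral_volume, Pi.smul_apply, smul_eq_mul, mul_left_comm _ c]
  exact integral_const_mul _ _

theorem mFourierCoeff_comp_add_right (f : UnitAddTorus (Fin p) → ℂ) (y : UnitAddTorus (Fin p))
    (n : Fin p → ℤ) :
    mFourierCoeff (fun x => f (x + y)) n = mFourier n y * mFourierCoeff f n := by
  simp only [mFourierCoeff_eq_integral_volume]
  rw [← integral_add_right_eq_self (fun t => mFourier (-n) t * f t) y, ← integral_const_mul]
  refine integral_congr_ae (Filter.Eventually.of_forall fun x => ?_)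
  beta_reduce
  rw [mFourier_apply_add, show mFourier n y * (mFourier (-n) x * mFourier (-n) y * f (x + y))
    = mFourier n y * mFourier (-n) y * (mFourier (-n) x * f (x + y)) by ring,
    mFourier_neg_mul_self, one_mul]

theorem continuous_torusMulVec (M : Matrix (Fin p) (Fin p) ℤ) : Continuous (torusMulVec M) := by
  unfold torusMulVec
  fun_prop

/-- The affine automorphism of the torus as a homeomorphism. -/
def torusAffineHomeomorph (A : Matrix.GeneralLinearGroup (Fin p) ℤ) (b : Fin p → ℝ) :
    UnitAddTorus (Fin p) ≃ₜ UnitAddTorus (Fin p) where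
  toEquiv := torusAffine A b
  continuous_toFun := (continuous_torusMulVec _).add continuous_const
  continuous_invFun := (continuous_torusMulVec _).comp (continuous_id.sub continuous_const)

theorem continuous_torusAffine_zpow (A : Matrix.GeneralLinearGroup (Fin p) ℤ) (b : Fin p → ℝ)
    (k : ℤ) : Continuous (torusAffine A b ^ k) := by
  induction k using Int.induction_on with
  | zero => exact continuous_id
  | succ k ih =>
    rw [zpow_add_one]
    exact ih.comp (torusAffineHomeomorph A b).continuous
  | pred k ih =>
    rw [zpow_sub_one]
    exact ih.comp (torusAffineHomeomorph A b).symm.continuous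

theorem measurePreserving_torusMulVec (A : Matrix.GeneralLinearGroup (Fin p) ℤ) :
    MeasurePreserving (torusMulVec (A : Matrix (Fin p) (Fin p) ℤ)) := by
  let φ : UnitAddTorus (Fin p) →+ UnitAddTorus (Fin p) :=
    AddMonoidHom.mk' (torusMulVec (A : Matrix (Fin p) (Fin p) ℤ)) fun x y => by
      funext i
      simp [torusMulVec, Finset.sum_add_distrib]
  -- A continuous surjective endomorphism of a compact group preserves Haar measure.
  refine φ.measurePreserving (continuous_torusMulVec _) (fun y => ?_) rfl
  refine ⟨torusMulVec ((A⁻¹ : Matrix.GeneralLinearGroup (Fin p) ℤ) :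
    Matrix (Fin p) (Fin p) ℤ) y, ?_⟩
  change torusMulVec _ (torusMulVec _ y) = y
  rw [← torusMulVec_mul, Units.mul_inv, torusMulVec_one]

theorem measurePreserving_torusAffine (A : Matrix.GeneralLinearGroup (Fin p) ℤ) (b : Fin p → ℝ) :
    MeasurePreserving (torusAffine A b) :=
  (measurePreserving_add_right volume (torusProj p b)).comp (measurePreserving_torusMulVec A)

/-- Invariance of the measure moves γ onto the character, and Θ₋ₙ ∘ γ is Θ₋ₘ times the constant
Θ₋ₙ(b), where m = Aᵀn. -/
theorem mFourierCoeff_comp_torusAffine (A : Matrix.GeneralLinearGroup (Fin p) ℤ) (b : Fin p → ℝ)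
    (f : UnitAddTorus (Fin p) → ℂ) (m : Fin p → ℤ) :
    mFourierCoeff (f ∘ torusAffine A b) m =
      mFourier (dualPerm A m) (torusProj p b) * mFourierCoeff f (dualPerm A m) := by
  set n := dualPerm A m
  have hm : m = (A : Matrix (Fin p) (Fin p) ℤ).transpose.mulVec n :=
    ((dualPerm A).symm_apply_apply m).symm
  simp only [mFourierCoeff_eq_integral_volume]
  rw [← (measurePreserving_torusAffine A b).integral_comp
    (torusAffineHomeomorph A b).measurableEmbedding fun t => mFourier (-n) t * f t,
    ← integral_const_mul]
  refine integral_congr_ae (Filter.Eventually.of_forall fun x => ?_)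
  beta_reduce
  have e : mFourier (-n) (torusAffine A b x) = mFourier (-m) x * mFourier (-n) (torusProj p b) := by
    rw [hm, ← Matrix.mulVec_neg, ← mFourier_torusMulVec, ← mFourier_apply_add]
    rfl
  rw [e, Function.comp_apply, show mFourier n (torusProj p b) * (mFourier (-m) x *
    mFourier (-n) (torusProj p b) * f (torusAffine A b x)) = mFourier n (torusProj p b) *
    mFourier (-n) (torusProj p b) * (mFourier (-m) x * f (torusAffine A b x)) by ring,
    mFourier_neg_mul_self, one_mul]

theorem norm_mFourierCoeff_comp_torusAffine_zpow (A : Matrix.GeneralLinearGroup (Fin p) ℤ)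
    (b : Fin p → ℝ) (f : UnitAddTorus (Fin p) → ℂ) (k : ℤ) (m : Fin p → ℤ) :
    ‖mFourierCoeff (f ∘ (torusAffine A b ^ k)) m‖ = ‖mFourierCoeff f ((dualPerm A ^ k) m)‖ := by
  have h1 : ∀ (f : UnitAddTorus (Fin p) → ℂ) m,
      ‖mFourierCoeff (f ∘ torusAffine A b) m‖ = ‖mFourierCoeff f (dualPerm A m)‖ := fun f m => by
    rw [mFourierCoeff_comp_torusAffine, norm_mul, norm_mFourier_apply, one_mul]
  induction k using Int.induction_on generalizing m with
  | zero => rfl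
  | succ k ih =>
    rw [zpow_add_one, zpow_add_one, Equiv.Perm.coe_mul, ← Function.comp_assoc, h1, ih]
    rfl
  | pred k ih =>
    have := h1 (f ∘ ⇑(torusAffine A b ^ (-(k : ℤ) - 1))) ((dualPerm A)⁻¹ m)
    rw [Function.comp_assoc, ← Equiv.Perm.coe_mul, ← zpow_add_one, sub_add_cancel, ih,
      show dualPerm A ((dualPerm A)⁻¹ m) = m from (dualPerm A).apply_symm_apply m] at this
    rw [← this, zpow_sub_one]
    rfl

end Torus

/-! ### Decay of Fourier coefficients of smooth functions. -/

namespace SmoothTorus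

variable {p : ℕ}

@[simp]
theorem add_apply (f g : SmoothTorus p) (x : UnitAddTorus (Fin p)) : (f + g) x = f x + g x := rfl

@[simp]
theorem sub_apply (f g : SmoothTorus p) (x : UnitAddTorus (Fin p)) : (f - g) x = f x - g x := rfl

@[simp]
theorem smul_apply (c : ℂ) (f : SmoothTorus p) (x : UnitAddTorus (Fin p)) :
    (c • f) x = c * f x := rfl

theorem isOpenQuotientMap_torusProj : IsOpenQuotientMap (torusProj p) :=
  IsOpenQuotientMap.piMap (f := fun _ (x : ℝ) => (x : UnitAddCircle)) fun _ =>
    QuotientAddGroup.isOpenQuotientMap_mk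

theorem torusProj_surjective : Function.Surjective (torusProj p) :=
  isOpenQuotientMap_torusProj.surjective

protected theorem continuous (h : SmoothTorus p) : Continuous h :=
  isOpenQuotientMap_torusProj.isQuotientMap.continuous_iff.2 h.contDiff.continuous

/-- The Fourier coefficient of a smooth function, as a linear form. -/
noncomputable def coeff (m : Fin p → ℤ) : SmoothTorus p →ₗ[ℂ] ℂ where
  toFun h := mFourierCoeff h m
  map_add' f g := mFourierCoeff_add f.continuous g.continuous m
  map_smul' c f := mFourierCoeff_smul c f m

theorem coeff_apply (m : Fin p → ℤ) (h : SmoothTorus p) : coeff m h = mFourierCoeff h m := rfl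

/-- The translate of a smooth function on the torus. -/
noncomputable def translate (y : Fin p → ℝ) (h : SmoothTorus p) : SmoothTorus p :=
  ⟨fun x => h (x + torusProj p y), by
    change ContDiff ℝ ∞ fun x => (h ∘ torusProj p) (x + y)
    exact h.contDiff.comp (contDiff_id.add contDiff_const)⟩

theorem coeff_translate (y : Fin p → ℝ) (h : SmoothTorus p) (m : Fin p → ℤ) :
    coeff m (translate y h) = mFourier m (torusProj p y) * coeff m h :=
  mFourierCoeff_comp_add_right h _ m

theorem iteratedDerivMap_sub (n : ℕ) (f g : SmoothTorus p) :
    iteratedDerivMap n (f - g) = iteratedDerivMap n f - iteratedDerivMap n g := by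
  ext1 x
  exact iteratedFDeriv_sub_apply (f.contDiff.contDiffAt.of_le (by exact_mod_cast le_top))
    (g.contDiff.contDiffAt.of_le (by exact_mod_cast le_top))

theorem iteratedDerivMap_add (n : ℕ) (f g : SmoothTorus p) :
    iteratedDerivMap n (f + g) = iteratedDerivMap n f + iteratedDerivMap n g := by
  ext1 x
  exact iteratedFDeriv_add_apply (f.contDiff.contDiffAt.of_le (by exact_mod_cast le_top))
    (g.contDiff.contDiffAt.of_le (by exact_mod_cast le_top))

theorem iteratedDerivMap_translate (n : ℕ) (y : Fin p → ℝ) (h : SmoothTorus p) (x : Fin p → ℝ) :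
    iteratedDerivMap n (translate y h) x = iteratedDerivMap n h (x + y) :=
  iteratedFDeriv_comp_add_right (f := h ∘ torusProj p) n y x

theorem norm_iteratedDerivMap_sub_translate_le (n : ℕ) (y : Fin p → ℝ) (h : SmoothTorus p) {C : ℝ}
    (hC : ∀ x, ‖iteratedDerivMap (n + 1) h x‖ ≤ C) (x : Fin p → ℝ) :
    ‖iteratedDerivMap n (h - translate y h) x‖ ≤ C * ‖y‖ := by
  rw [iteratedDerivMap_sub, ContinuousMap.sub_apply, iteratedDerivMap_translate, norm_sub_rev]
  have := Convex.norm_image_sub_le_of_norm_fderiv_le (𝕜 := ℝ) (s := Set.univ)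
    (f := iteratedFDeriv ℝ n (h ∘ torusProj p)) (C := C) (x := x) (y := x + y)
    (fun z _ => (h.contDiff.differentiable_iteratedFDeriv
      (by exact_mod_cast ENat.natCast_lt_top n)).differentiableAt)
    (fun z _ => by rw [norm_fderiv_iteratedFDeriv]; exact hC z) convex_univ trivial trivial
  rwa [add_sub_cancel_left] at this

/-- Move by half a period in a coordinate where |m_j| is maximal. The resulting sign change serves
both for decay of coefficients and for orthogonality of characters. -/
theorem exists_mFourier_torusProj_eq_neg_one {m : Fin p → ℤ} (hm : m ≠ 0) :
    ∃ y : Fin p → ℝ, ‖y‖ = 1 / (2 * ‖m‖) ∧ mFourier m (torusProj p y) = -1 := by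
  have hm1 := one_le_norm_of_ne_zero hm
  obtain ⟨j, hj⟩ : ∃ j, ‖m j‖ = ‖m‖ := by
    by_contra! hne
    exact lt_irrefl _ ((pi_norm_lt_iff (one_pos.trans_le hm1)).2 fun j =>
      lt_of_le_of_ne (norm_le_pi_norm m j) (hne j))
  have hmj : (m j : ℝ) ≠ 0 := by
    intro h0
    rw [← hj, Int.norm_eq_abs, h0, abs_zero] at hm1
    exact absurd hm1 (by norm_num)
  refine ⟨Pi.single j (1 / (2 * (m j : ℝ))), ?_, ?_⟩
  · rw [Pi.norm_single, ← hj, Int.norm_eq_abs]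
    simp
  · rw [mFourier, ContinuousMap.coe_mk, Finset.prod_eq_single j]
    · rw [torusProj, fourier_coe_apply, Pi.single_eq_same]
      have : (2 * Real.pi * Complex.I * (m j) * ((1 / (2 * (m j : ℝ)) : ℝ) : ℂ) / (1 : ℝ) : ℂ)
          = Real.pi * Complex.I := by
        have : (m j : ℂ) ≠ 0 := by exact_mod_cast hmj
        push_cast
        field_simp
      rw [this, Complex.exp_pi_mul_I]
    · intro i _ hi
      simp [torusProj, Pi.single_eq_of_ne hi]
    · simp

/-- Each derivative gains a factor of the order of the frequency. -/
theorem norm_coeff_mul_pow_le (n : ℕ) (m : Fin p → ℤ) (hm : m ≠ 0) (h : SmoothTorus p) {C : ℝ}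
    (hC : ∀ x, ‖iteratedDerivMap n h x‖ ≤ C) : ‖m‖ ^ n * ‖coeff m h‖ ≤ C := by
  have hm1 := one_le_norm_of_ne_zero hm
  induction n generalizing h C with
  | zero =>
    rw [pow_zero, one_mul]
    refine norm_mFourierCoeff_le (fun x => ?_) m
    obtain ⟨y, rfl⟩ := torusProj_surjective x
    have := hC y
    rwa [iteratedDerivMap, ContinuousMap.coe_mk, norm_iteratedFDeriv_zero] at this
  | succ n ih =>
    obtain ⟨y, hny, hchar⟩ := exists_mFourier_torusProj_eq_neg_one hm
    -- This replaces integration by parts: the difference doubles the coefficient, while the mean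
    -- value inequality trades one derivative for ‖y‖ = 1/(2‖m‖).
    have h2 : coeff m (h - translate y h) = 2 * coeff m h := by
      rw [map_sub, coeff_translate, hchar]
      ring
    have h3 := ih _ (norm_iteratedDerivMap_sub_translate_le n y h hC)
    rw [h2, hny, norm_mul, Complex.norm_ofNat] at h3
    have hpos : 0 < ‖m‖ := one_pos.trans_le hm1
    have hC0 : 0 ≤ C := (norm_nonneg _).trans (hC 0)
    have h4 := mul_le_mul_of_nonneg_left h3 hpos.le
    have e1 : ‖m‖ * (C * (1 / (2 * ‖m‖))) = C / 2 := by
      field_simp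
    rw [e1] at h4
    calc ‖m‖ ^ (n + 1) * ‖coeff m h‖ = ‖m‖ * (‖m‖ ^ n * (2 * ‖coeff m h‖)) / 2 := by ring
      _ ≤ C / 2 / 2 := by gcongr
      _ ≤ C := by linarith

end SmoothTorus

/-! ### Weights on frequencies and rapidly decreasing families. -/

section Weight

variable {p : ℕ}

/-- The weight `max 1 ‖m‖` of a frequency `m`. -/
noncomputable def freqWeight (m : Fin p → ℤ) : ℝ := max 1 ‖m‖

theorem one_le_freqWeight (m : Fin p → ℤ) : 1 ≤ freqWeight m := le_max_left _ _

theorem freqWeight_pos (m : Fin p → ℤ) : 0 < freqWeight m := one_pos.trans_le (one_le_freqWeight m)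

theorem norm_le_freqWeight (m : Fin p → ℤ) : ‖m‖ ≤ freqWeight m := le_max_right _ _

theorem freqWeight_of_ne_zero {m : Fin p → ℤ} (hm : m ≠ 0) : freqWeight m = ‖m‖ :=
  max_eq_right (one_le_norm_of_ne_zero hm)

theorem norm_intCast_comp_real (m : Fin p → ℤ) : ‖fun i => (m i : ℝ)‖ = ‖m‖ := by
  have h : ∀ i, ‖(m i : ℝ)‖₊ = ‖m i‖₊ := fun i => NNReal.eq (by
    rw [coe_nnnorm, coe_nnnorm, Real.norm_eq_abs, Int.norm_eq_abs])
  simp only [Pi.norm_def, h]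

/-- Away from m = 0 this is the convergent sum of ‖x‖⁻ᵈ over a lattice, for d exceeding its rank. -/
theorem exists_summable_inv_freqWeight_pow (p : ℕ) :
    ∃ d : ℕ, Summable fun m : Fin p → ℤ => (freqWeight m)⁻¹ ^ d := by
  set L := Submodule.span ℤ (Set.range (Pi.basisFun ℝ (Fin p)))
  have hL : ∀ m : Fin p → ℤ, (fun i => (m i : ℝ)) ∈ L := fun m => by
    rw [Module.Basis.mem_span_iff_repr_mem]
    intro i
    simp
  refine ⟨Module.finrank ℤ L + 1, ?_⟩
  have h := (ZLattice.summable_norm_pow_inv L _ (Nat.lt_succ_self _)).comp_injective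
    (i := fun m : Fin p → ℤ => (⟨fun i => (m i : ℝ), hL m⟩ : L)) (fun m n hmn => by
      funext i
      exact Int.cast_injective (α := ℝ) (congrFun (Subtype.ext_iff.1 hmn) i))
  refine h.congr_cofinite ?_
  filter_upwards [(Set.finite_singleton (0 : Fin p → ℤ)).compl_mem_cofinite] with m hm
  rw [freqWeight_of_ne_zero hm, ← norm_intCast_comp_real]
  rfl

/-- A family indexed by frequencies is rapidly decreasing. -/
def RapidDecay (c : (Fin p → ℤ) → ℂ) : Prop := ∀ N : ℕ, ∃ C, ∀ m, freqWeight m ^ N * ‖c m‖ ≤ C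

theorem norm_mul_pow_le_of_le {d n : ℕ} {c : ℂ} {m : Fin p → ℤ} {C : ℝ}
    (h : freqWeight m ^ (n + d) * ‖c‖ ≤ C) : ‖c‖ * freqWeight m ^ n ≤ C * (freqWeight m)⁻¹ ^ d := by
  have hw := freqWeight_pos m
  rw [inv_pow, ← div_eq_mul_inv, le_div_iff₀ (by positivity)]
  calc ‖c‖ * freqWeight m ^ n * freqWeight m ^ d = freqWeight m ^ (n + d) * ‖c‖ := by ring
    _ ≤ C := h

theorem RapidDecay.summable {c : (Fin p → ℤ) → ℂ} (hc : RapidDecay c) (n : ℕ) :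
    Summable fun m => ‖c m‖ * freqWeight m ^ n := by
  obtain ⟨d, hd⟩ := exists_summable_inv_freqWeight_pow p
  obtain ⟨C, hC⟩ := hc (n + d)
  exact Summable.of_nonneg_of_le (fun m => mul_nonneg (norm_nonneg _)
    (pow_nonneg (freqWeight_pos m).le n)) (fun m => norm_mul_pow_le_of_le (hC m)) (hd.mul_left C)

theorem RapidDecay.summable_norm {c : (Fin p → ℤ) → ℂ} (hc : RapidDecay c) :
    Summable fun m => ‖c m‖ := by
  simpa using hc.summable 0

end Weight

theorem iteratedDeriv_cexp_const_mul_ofReal (n : ℕ) (c : ℂ) :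
    (iteratedDeriv n fun t : ℝ => Complex.exp (c * t)) = fun t : ℝ => c ^ n * Complex.exp (c * t) := by
  induction n with
  | zero => simp
  | succ n ih =>
    rw [iteratedDeriv_succ, ih]
    funext t
    have h : HasDerivAt (fun t : ℝ => Complex.exp (c * t)) (Complex.exp (c * t) * (c * 1)) t :=
      ((Complex.ofRealCLM.hasDerivAt (x := t)).const_mul c).cexp
    rw [(h.const_mul (c ^ n)).deriv]
    ring

/-! ### Fourier synthesis, and comparison of derivatives with coefficients. -/

namespace SmoothTorus

variable {p : ℕ}

theorem ext {f g : SmoothTorus p} (h : ∀ x, f x = g x) : f = g := DFunLike.ext _ _ h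

theorem iteratedDerivMap_smul (n : ℕ) (c : ℂ) (f : SmoothTorus p) :
    iteratedDerivMap n (c • f) = c • iteratedDerivMap n f := by
  ext1 x
  exact iteratedFDeriv_const_smul_apply (f.contDiff.contDiffAt.of_le (by exact_mod_cast le_top))

theorem character_apply (m : Fin p → ℤ) (x : UnitAddTorus (Fin p)) :
    character m x = mFourier m x := rfl

/-- The linear form `x ↦ ⟨x, m⟩`. -/
noncomputable def freqForm (m : Fin p → ℤ) : (Fin p → ℝ) →L[ℝ] ℝ :=
  ∑ i, (m i : ℝ) • ContinuousLinearMap.proj i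

theorem norm_freqForm_le (m : Fin p → ℤ) : ‖freqForm m‖ ≤ p * ‖m‖ := by
  refine ContinuousLinearMap.opNorm_le_bound _ (by positivity) fun x => ?_
  simp only [freqForm, sum_apply, _root_.smul_apply,
    ContinuousLinearMap.proj_apply, smul_eq_mul]
  refine (norm_sum_le _ _).trans ((Finset.sum_le_sum (g := fun _ => ‖m‖ * ‖x‖) fun i _ => ?_).trans
    (by simp [mul_assoc]))
  rw [norm_mul]
  gcongr
  · exact (norm_le_pi_norm m i).trans_eq' (by rw [Real.norm_eq_abs, Int.norm_eq_abs])
  · exact norm_le_pi_norm x i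

/-- Factoring through one real variable reduces all derivatives of a character to those of t ↦
exp(2πit). -/
theorem character_comp_torusProj (m : Fin p → ℤ) : (character m : UnitAddTorus (Fin p) → ℂ) ∘
    torusProj p = (fun t : ℝ => Complex.exp (2 * Real.pi * Complex.I * t)) ∘ freqForm m := by
  funext x
  simp only [Function.comp_apply, character_apply, mFourier, ContinuousMap.coe_mk, torusProj,
    fourier_coe_apply, freqForm, sum_apply, _root_.smul_apply,
    ContinuousLinearMap.proj_apply, smul_eq_mul, ← Complex.exp_sum]
  congr 1
  push_cast
  rw [Finset.mul_sum]
  exact Finset.sum_congr rfl fun i _ => by ring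

theorem norm_iteratedDerivMap_character_le (n : ℕ) (m : Fin p → ℤ) (x : Fin p → ℝ) :
    ‖iteratedDerivMap n (character m) x‖ ≤ (2 * Real.pi * p) ^ n * freqWeight m ^ n := by
  have hcd : ContDiff ℝ ∞ fun t : ℝ => Complex.exp (2 * Real.pi * Complex.I * t) :=
    (contDiff_const.mul Complex.ofRealCLM.contDiff).cexp
  have e : iteratedDerivMap n (character m) x = (iteratedFDeriv ℝ n
      (fun t : ℝ => Complex.exp (2 * Real.pi * Complex.I * t))
        (freqForm m x)).compContinuousLinearMap fun _ => freqForm m := by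
    rw [iteratedDerivMap, ContinuousMap.coe_mk, character_comp_torusProj,
      (freqForm m).iteratedFDeriv_comp_right hcd x (by exact_mod_cast le_top)]
  rw [e]
  refine (ContinuousMultilinearMap.norm_compContinuousLinearMap_le _ _).trans ?_
  rw [norm_iteratedFDeriv_eq_norm_iteratedDeriv, iteratedDeriv_cexp_const_mul_ofReal, norm_mul,
    norm_pow, show (2 * Real.pi * Complex.I * (freqForm m x : ℂ) : ℂ)
      = ((2 * Real.pi * freqForm m x : ℝ) : ℂ) * Complex.I by push_cast; ring,
    Complex.norm_exp_ofReal_mul_I, mul_one, Finset.prod_const, Finset.card_univ, Fintype.card_fin,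
    ← mul_pow, ← mul_pow]
  have h1 : ‖(2 * Real.pi * Complex.I : ℂ)‖ = 2 * Real.pi := by
    simp [Real.pi_pos.le, abs_of_nonneg]
  rw [h1, mul_assoc (2 * Real.pi)]
  gcongr
  exact (norm_freqForm_le m).trans (by gcongr; exact norm_le_freqWeight m)

theorem norm_iteratedDerivMap_smul_character_le (n : ℕ) (c : ℂ) (m : Fin p → ℤ) (x : Fin p → ℝ) :
    ‖iteratedDerivMap n (c • character m) x‖ ≤
      (2 * Real.pi * p) ^ n * (‖c‖ * freqWeight m ^ n) := by
  rw [iteratedDerivMap_smul, ContinuousMap.smul_apply, norm_smul, mul_left_comm]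
  gcongr
  exact norm_iteratedDerivMap_character_le n m x

/-- The smooth function with prescribed rapidly decreasing Fourier coefficients. -/
noncomputable def ofCoeff (c : (Fin p → ℤ) → ℂ) (hc : RapidDecay c) : SmoothTorus p :=
  ⟨fun x => ∑' m, c m * mFourier m x,
    contDiff_tsum (N := ⊤) (f := fun m => (c m • character m : SmoothTorus p) ∘ torusProj p)
      (fun m => (c m • character m : SmoothTorus p).contDiff)
      (fun k _ => (hc.summable k).mul_left ((2 * Real.pi * p) ^ k))
      fun k m x _ => norm_iteratedDerivMap_smul_character_le k (c m) m x⟩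

theorem norm_iteratedDerivMap_ofCoeff_le (n : ℕ) (c : (Fin p → ℤ) → ℂ) (hc : RapidDecay c)
    (x : Fin p → ℝ) : ‖iteratedDerivMap n (ofCoeff c hc) x‖ ≤
      (2 * Real.pi * p) ^ n * ∑' m, ‖c m‖ * freqWeight m ^ n := by
  have e := iteratedFDeriv_tsum (𝕜 := ℝ) (N := ⊤)
    (f := fun m => (c m • character m : SmoothTorus p) ∘ torusProj p)
    (fun m => (c m • character m : SmoothTorus p).contDiff)
    (fun k _ => (hc.summable k).mul_left ((2 * Real.pi * p) ^ k))
    (fun k m x _ => norm_iteratedDerivMap_smul_character_le k (c m) m x) (k := n) le_top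
  change ‖iteratedFDeriv ℝ n (fun y => ∑' m, ((c m • character m : SmoothTorus p) ∘
    torusProj p) y) x‖ ≤ _
  rw [e, ← tsum_mul_left]
  exact tsum_of_norm_bounded ((hc.summable n).mul_left ((2 * Real.pi * p) ^ n)).hasSum
    fun m => norm_iteratedDerivMap_smul_character_le n (c m) m x

theorem mFourierCoeff_mFourier (m n : Fin p → ℤ) :
    mFourierCoeff (mFourier n) m = if m = n then 1 else 0 := by
  rw [mFourierCoeff_eq_integral_volume]
  split_ifs with h
  · subst h
    simp only [mul_comm (mFourier (-m) _), mFourier_neg_mul_self]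
    simp
  · simp only [← mFourier_add]
    -- A translation that negates the integrand preserves the integral, which is therefore 0.
    obtain ⟨y, -, hy⟩ := exists_mFourier_torusProj_eq_neg_one
      (m := -m + n) (by rwa [Ne, neg_add_eq_zero])
    have := integral_add_right_eq_self (μ := volume) (fun t => mFourier (-m + n) t) (torusProj p y)
    simp only [mFourier_apply_add, hy, mul_neg_one, integral_neg] at this
    exact self_eq_neg.1 this.symm

theorem coeff_character (m n : Fin p → ℤ) : coeff m (character n) = if m = n then 1 else 0 :=
  mFourierCoeff_mFourier m n

theorem coeff_ofCoeff (c : (Fin p → ℤ) → ℂ) (hc : RapidDecay c) (m : Fin p → ℤ) :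
    coeff m (ofCoeff c hc) = c m := by
  have h := hasSum_integral_of_summable_integral_norm (μ := volume)
    (F := fun n (x : UnitAddTorus (Fin p)) => mFourier (-m) x * (c n * mFourier n x))
    (fun n => integrable_mFourier_mul (continuous_const.mul (mFourier n).continuous) _)
    (by simpa [norm_mFourier_apply] using hc.summable_norm)
  have e : ∀ n, ∫ x, mFourier (-m) x * (c n * mFourier n x) = if n = m then c m else 0 := by
    intro n
    simp only [mul_left_comm _ (c n)]
    rw [integral_const_mul, ← mFourierCoeff_eq_integral_volume, mFourierCoeff_mFourier]
    by_cases hn : n = m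
    · subst hn; simp
    · simp [hn, Ne.symm hn]
  simp only [e, tsum_mul_left] at h
  rw [coeff_apply, mFourierCoeff_eq_integral_volume]
  exact h.unique (hasSum_ite_eq m (c m))

theorem translate_intCast (k : Fin p → ℤ) (h : SmoothTorus p) :
    translate (fun i => (k i : ℝ)) h = h := by
  have : torusProj p (fun i => (k i : ℝ)) = 0 := by
    funext i
    exact (AddCircle.coe_eq_zero_iff (1 : ℝ)).2 ⟨k i, by simp⟩
  refine ext fun x => ?_
  change h (x + torusProj p _) = h x
  rw [this, add_zero]

theorem iteratedDerivMap_fract (n : ℕ) (h : SmoothTorus p) (x : Fin p → ℝ) :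
    iteratedDerivMap n h (fun i => Int.fract (x i)) = iteratedDerivMap n h x := by
  conv_lhs => rw [← translate_intCast (fun i => ⌊x i⌋) h]
  rw [iteratedDerivMap_translate]
  congr 1
  funext i
  exact Int.fract_add_floor (x i)

/-- By periodicity one compact cube controls everything, so the compact-open topologies amount to
uniform convergence on ℝᵖ. -/
theorem norm_iteratedDerivMap_le {n : ℕ} {h : SmoothTorus p} {C : ℝ}
    (hC : ∀ x ∈ Set.Icc (0 : Fin p → ℝ) 1, ‖iteratedDerivMap n h x‖ ≤ C) (x : Fin p → ℝ) :
    ‖iteratedDerivMap n h x‖ ≤ C := by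
  rw [← iteratedDerivMap_fract]
  exact hC _ ⟨fun i => Int.fract_nonneg _, fun i => (Int.fract_lt_one _).le⟩

theorem exists_norm_iteratedDerivMap_le (n : ℕ) (h : SmoothTorus p) :
    ∃ C, ∀ x, ‖iteratedDerivMap n h x‖ ≤ C := by
  obtain ⟨C, hC⟩ := (isCompact_Icc (a := (0 : Fin p → ℝ)) (b := 1)).exists_bound_of_continuousOn
    (iteratedDerivMap n h).continuous.continuousOn
  exact ⟨C, norm_iteratedDerivMap_le hC⟩

theorem freqWeight_pow_mul_norm_coeff_le {n : ℕ} {h : SmoothTorus p} {C : ℝ}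
    (h0 : ∀ x, ‖iteratedDerivMap 0 h x‖ ≤ C) (hn : ∀ x, ‖iteratedDerivMap n h x‖ ≤ C)
    (m : Fin p → ℤ) : freqWeight m ^ n * ‖coeff m h‖ ≤ C := by
  by_cases hm : m = 0
  · subst hm
    rw [freqWeight, norm_zero, max_eq_left zero_le_one, one_pow, one_mul]
    refine norm_mFourierCoeff_le (fun x => ?_) 0
    obtain ⟨y, rfl⟩ := torusProj_surjective x
    have := h0 y
    rwa [iteratedDerivMap, ContinuousMap.coe_mk, norm_iteratedFDeriv_zero] at this
  · rw [freqWeight_of_ne_zero hm]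
    exact norm_coeff_mul_pow_le n m hm h hn

theorem rapidDecay_coeff (h : SmoothTorus p) : RapidDecay fun m => coeff m h := by
  intro n
  obtain ⟨C₀, h₀⟩ := exists_norm_iteratedDerivMap_le 0 h
  obtain ⟨C, hC⟩ := exists_norm_iteratedDerivMap_le n h
  exact ⟨max C₀ C, freqWeight_pow_mul_norm_coeff_le (fun x => (h₀ x).trans (le_max_left _ _))
    fun x => (hC x).trans (le_max_right _ _)⟩

theorem ofCoeff_coeff (h : SmoothTorus p) : ofCoeff (fun m => coeff m h) h.rapidDecay_coeff = h := by
  refine ext fun x => ?_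
  exact (hasSum_mFourier_series_apply_of_summable (f := ⟨h, h.continuous⟩)
    h.rapidDecay_coeff.summable_norm.of_norm x).tsum_eq

theorem ext_coeff {f g : SmoothTorus p} (h : ∀ m, coeff m f = coeff m g) : f = g := by
  rw [← ofCoeff_coeff f, ← ofCoeff_coeff g]
  simp only [h]

/-- Converse to `freqWeight_pow_mul_norm_coeff_le`, losing the d powers needed to sum over
frequencies. Together they show that both families of seminorms define the same topology. -/
theorem exists_norm_iteratedDerivMap_le_mul (p n : ℕ) : ∃ (K : ℝ) (N : ℕ), ∀ (h : SmoothTorus p)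
    (C : ℝ), (∀ m, freqWeight m ^ N * ‖coeff m h‖ ≤ C) → ∀ x, ‖iteratedDerivMap n h x‖ ≤ K * C := by
  obtain ⟨d, hd⟩ := exists_summable_inv_freqWeight_pow p
  refine ⟨(2 * Real.pi * p) ^ n * ∑' m : Fin p → ℤ, (freqWeight m)⁻¹ ^ d, n + d,
    fun h C hC x => ?_⟩
  rw [← ofCoeff_coeff h, mul_assoc, ← tsum_mul_right]
  refine (norm_iteratedDerivMap_ofCoeff_le _ _ _ _).trans ?_
  refine mul_le_mul_of_nonneg_left ?_ (by positivity)
  exact (h.rapidDecay_coeff.summable n).tsum_le_tsum (hg := hd.mul_right C)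
    fun m => (norm_mul_pow_le_of_le (hC m)).trans_eq (mul_comm _ _)

end SmoothTorus

/-! ### The Fréchet structure through weighted coefficients. -/

section Frechet

open Filter Topology

namespace SmoothTorus

variable {p : ℕ}

/-- The iterated derivative as an additive map. -/
noncomputable def iteratedDerivHom (p n : ℕ) :
    SmoothTorus p →+ C(Fin p → ℝ, (Fin p → ℝ) [×n]→L[ℝ] ℂ) :=
  AddMonoidHom.mk' (iteratedDerivMap n) (iteratedDerivMap_add n)

theorem isTopologicalAddGroup (p : ℕ) : IsTopologicalAddGroup (SmoothTorus p) :=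
  topologicalAddGroup_iInf fun n => topologicalAddGroup_induced (iteratedDerivHom p n)

theorem continuous_iteratedDerivMap (n : ℕ) : Continuous (iteratedDerivMap (p := p) n) :=
  continuous_iInf_dom continuous_induced_dom

/-- The weighted Fourier coefficients of a smooth function, as a bounded family. -/
noncomputable def weightedCoeff (p N : ℕ) :
    SmoothTorus p →ₗ[ℂ] lp (fun _ : Fin p → ℤ => ℂ) ⊤ where
  toFun h := ⟨fun m => (freqWeight m : ℂ) ^ N * coeff m h, memℓp_infty (by
    obtain ⟨C, hC⟩ := h.rapidDecay_coeff N
    refine ⟨C, ?_⟩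
    rintro _ ⟨m, rfl⟩
    refine (hC m).trans_eq' ?_
    beta_reduce
    rw [norm_mul, norm_pow, Complex.norm_real, Real.norm_of_nonneg (freqWeight_pos m).le])⟩
  map_add' f g := by
    ext m
    exact (congrArg _ (map_add (coeff m) f g)).trans (mul_add _ _ _)
  map_smul' c f := by
    ext m
    exact (congrArg _ (map_smul (coeff m) c f)).trans (mul_left_comm _ _ _)

theorem weightedCoeff_apply (N : ℕ) (h : SmoothTorus p) (m : Fin p → ℤ) :
    weightedCoeff p N h m = (freqWeight m : ℂ) ^ N * coeff m h := rfl

theorem norm_weightedCoeff_apply (N : ℕ) (h : SmoothTorus p) (m : Fin p → ℤ) :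
    ‖weightedCoeff p N h m‖ = freqWeight m ^ N * ‖coeff m h‖ := by
  rw [weightedCoeff_apply, norm_mul, norm_pow, Complex.norm_real,
    Real.norm_of_nonneg (freqWeight_pos m).le]

theorem norm_weightedCoeff_le {N : ℕ} {h : SmoothTorus p} {C : ℝ}
    (hC : ∀ m, freqWeight m ^ N * ‖coeff m h‖ ≤ C) : ‖weightedCoeff p N h‖ ≤ C :=
  lp.norm_le_of_forall_le ((mul_nonneg (pow_nonneg (freqWeight_pos 0).le _) (norm_nonneg _)).trans
    (hC 0)) fun m => (norm_weightedCoeff_apply N h m).trans_le (hC m)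

theorem freqWeight_pow_mul_norm_coeff_le_norm (N : ℕ) (h : SmoothTorus p) (m : Fin p → ℤ) :
    freqWeight m ^ N * ‖coeff m h‖ ≤ ‖weightedCoeff p N h‖ :=
  (norm_weightedCoeff_apply N h m).symm.trans_le (lp.norm_apply_le_norm ENNReal.top_ne_zero _ _)

theorem eventually_norm_iteratedDerivMap_lt (n : ℕ) {ε : ℝ} (hε : 0 < ε) :
    ∀ᶠ h in 𝓝 (0 : SmoothTorus p), ∀ x, ‖iteratedDerivMap n h x‖ ≤ ε := by
  have h := (continuous_iteratedDerivMap (p := p) n).tendsto 0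
  rw [ContinuousMap.tendsto_iff_forall_isCompact_tendstoUniformlyOn] at h
  have h1 := Metric.tendstoUniformlyOn_iff.1 (h (Set.Icc 0 1) isCompact_Icc) ε hε
  filter_upwards [h1] with f hf
  refine norm_iteratedDerivMap_le fun x hx => ?_
  have h0 : iteratedDerivMap n (0 : SmoothTorus p) x = 0 := by
    have := (iteratedDerivHom p n).map_zero
    exact congrArg (fun g => g x) this
  have := hf x hx
  rw [h0, dist_zero_left] at this
  exact this.le

theorem continuous_weightedCoeff (p N : ℕ) : Continuous (weightedCoeff p N) := by
  have := isTopologicalAddGroup p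
  refine continuous_of_continuousAt_zero _ ?_
  rw [ContinuousAt, map_zero, Metric.tendsto_nhds]
  intro ε hε
  filter_upwards [eventually_norm_iteratedDerivMap_lt (p := p) 0 (half_pos hε),
    eventually_norm_iteratedDerivMap_lt (p := p) N (half_pos hε)] with h h0 hN
  rw [dist_zero_right]
  exact (norm_weightedCoeff_le (freqWeight_pow_mul_norm_coeff_le h0 hN)).trans_lt (half_lt_self hε)

/-- All weighted families of Fourier coefficients of a smooth function. -/
noncomputable def allWeightedCoeff (p : ℕ) :
    SmoothTorus p →ₗ[ℂ] (ℕ → lp (fun _ : Fin p → ℤ => ℂ) ⊤) :=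
  LinearMap.pi (weightedCoeff p)

theorem isInducing_allWeightedCoeff (p : ℕ) : IsInducing (allWeightedCoeff p) := by
  refine ⟨le_antisymm (continuous_iff_le_induced.1
    (continuous_pi fun N => continuous_weightedCoeff p N)) (le_iInf fun n => ?_)⟩
  rw [← continuous_iff_le_induced]
  let t : TopologicalSpace (SmoothTorus p) :=
    TopologicalSpace.induced (allWeightedCoeff p) inferInstance
  have : IsTopologicalAddGroup (SmoothTorus p) := topologicalAddGroup_induced (allWeightedCoeff p)
  have hJ : ∀ N, Continuous (weightedCoeff p N) := fun N =>
    (continuous_apply N).comp (continuous_induced_dom (f := allWeightedCoeff p))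
  refine continuous_of_continuousAt_zero (iteratedDerivHom p n) ?_
  rw [ContinuousAt, map_zero, ContinuousMap.tendsto_iff_forall_isCompact_tendstoUniformlyOn]
  intro S _
  rw [Metric.tendstoUniformlyOn_iff]
  intro ε hε
  obtain ⟨K, N, hK⟩ := exists_norm_iteratedDerivMap_le_mul p n
  have hlim : Tendsto (fun h => K * ‖weightedCoeff p N h‖) (𝓝 0) (𝓝 0) := by
    have := ((hJ N).norm.const_mul K).tendsto 0
    rwa [map_zero, norm_zero, mul_zero] at this
  filter_upwards [hlim.eventually (gt_mem_nhds hε)] with h hh x _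
  rw [ContinuousMap.zero_apply, dist_zero_left]
  exact (hK h _ (freqWeight_pow_mul_norm_coeff_le_norm N h) x).trans_lt hh

theorem allWeightedCoeff_injective (p : ℕ) : Function.Injective (allWeightedCoeff p) := by
  intro f g h
  refine ext_coeff fun m => ?_
  have := congrArg (fun c => c m) (congrFun h 0)
  simpa [allWeightedCoeff, weightedCoeff_apply] using this

/-- The range is cut out by the closed compatibility conditions between level N and level 0;
boundedness of every level is exactly rapid decay, so synthesis supplies a preimage. -/
theorem isClosed_range_allWeightedCoeff (p : ℕ) : IsClosed (Set.range (allWeightedCoeff p)) := by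
  have e : Set.range (allWeightedCoeff p) =
      ⋂ (N : ℕ) (m : Fin p → ℤ), {f | f N m = (freqWeight m : ℂ) ^ N * f 0 m} := by
    ext f
    simp only [Set.mem_iInter, Set.mem_ofPred_eq]
    refine ⟨?_, fun h => ?_⟩
    · rintro ⟨h, rfl⟩ N m
      simp [allWeightedCoeff, weightedCoeff_apply]
    · have hc : RapidDecay fun m => f 0 m := fun N => ⟨‖f N‖, fun m => by
        have := lp.norm_apply_le_norm ENNReal.top_ne_zero (f N) m
        rwa [h N m, norm_mul, norm_pow, Complex.norm_real,
          Real.norm_of_nonneg (freqWeight_pos m).le] at this⟩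
      refine ⟨ofCoeff _ hc, ?_⟩
      funext N
      ext m
      rw [h N m]
      change weightedCoeff p N _ m = _
      rw [weightedCoeff_apply, coeff_ofCoeff]
  rw [e]
  have hev : ∀ (N : ℕ) (m : Fin p → ℤ),
      Continuous fun f : ℕ → lp (fun _ : Fin p → ℤ => ℂ) ⊤ => f N m := fun N m =>
    ((continuous_apply m).comp (lp.uniformContinuous_coe (p := ⊤)).continuous).comp
      (continuous_apply N)
  exact isClosed_iInter fun N => isClosed_iInter fun m =>
    isClosed_eq (hev N m) (continuous_const.mul (hev 0 m))

theorem isFrechetSpace (p : ℕ) : IsFrechetSpace (SmoothTorus p) where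
  isTopologicalAddGroup := isTopologicalAddGroup p
  continuousSMul := (isInducing_allWeightedCoeff p).continuousSMul continuous_id (map_smul _ _ _)
  locallyConvexSpace :=
    IsInducing.locallyConvexSpace (f := (allWeightedCoeff p).restrictScalars ℝ)
      (isInducing_allWeightedCoeff p)
  metrizableSpace :=
    IsEmbedding.metrizableSpace ⟨isInducing_allWeightedCoeff p, allWeightedCoeff_injective p⟩
  completeSpace := by
    have := isTopologicalAddGroup p
    let := IsTopologicalAddGroup.rightUniformSpace (SmoothTorus p)
    have := isUniformAddGroup_of_addCommGroup (G := SmoothTorus p)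
    have hu : IsUniformInducing (allWeightedCoeff p) :=
      AddMonoidHom.isUniformInducing_of_isInducing (isInducing_allWeightedCoeff p)
    rw [completeSpace_iff_isComplete_range hu]
    exact (isClosed_range_allWeightedCoeff p).isComplete

end SmoothTorus

/-- The quotient map is open, so it carries a convex basis at 0 to one. First countability passes to
the quotient and, with closedness of S for separation, gives metrizability; completeness also rests
on first countability. -/
theorem IsFrechetSpace.quotient {E : Type*} [AddCommGroup E] [Module ℂ E] [TopologicalSpace E]
    (hE : IsFrechetSpace E) (S : Submodule ℂ E) (hS : IsClosed (S : Set E)) :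
    IsFrechetSpace (E ⧸ S) := by
  have := hE.isTopologicalAddGroup
  have := hE.continuousSMul
  have := hE.locallyConvexSpace
  have := hE.metrizableSpace
  have hfc : FirstCountableTopology E :=
    let := TopologicalSpace.metrizableSpaceMetric E
    inferInstance
  have hfc' : FirstCountableTopology (E ⧸ S) :=
    QuotientAddGroup.instFirstCountableTopology S.toAddSubgroup
  refine ⟨inferInstance, inferInstance, ?_, ?_, ?_⟩
  · have hb := (LocallyConvexSpace.convex_basis_zero ℝ E).map S.mkQ
    rw [(S.isOpenQuotientMap_mkQ).map_nhds_eq, map_zero] at hb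
    exact LocallyConvexSpace.ofBasisZero ℝ (E ⧸ S) _ _ hb fun s hs =>
      hs.2.linear_image (S.mkQ.restrictScalars ℝ)
  · let := IsTopologicalAddGroup.rightUniformSpace (E ⧸ S)
    have := isUniformAddGroup_of_addCommGroup (G := E ⧸ S)
    have : (uniformity (E ⧸ S)).IsCountablyGenerated :=
      IsUniformAddGroup.uniformity_countably_generated
    exact UniformSpace.metrizableSpace
  · have := @QuotientAddGroup.completeSpace_right' E _ _ _ hfc S.toAddSubgroup _ hE.completeSpace
    exact this

theorem LinearMap.continuous_of_norm_le {V E F : Type*} [AddCommGroup V] [Module ℂ V]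
    [TopologicalSpace V] [IsTopologicalAddGroup V] [NormedAddCommGroup E] [NormedSpace ℂ E]
    [NormedAddCommGroup F] [NormedSpace ℂ F] {J : V →ₗ[ℂ] E} (hJ : Continuous J) (f : V →ₗ[ℂ] F)
    (C : ℝ) (h : ∀ v, ‖f v‖ ≤ C * ‖J v‖) : Continuous f := by
  refine continuous_of_continuousAt_zero f ?_
  rw [ContinuousAt, map_zero]
  refine squeeze_zero_norm h ?_
  have := (hJ.norm.const_mul C).tendsto 0
  rwa [map_zero, norm_zero, mul_zero] at this

/-! ### Fourier series in C^∞ and convergence of orbit sums. -/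

namespace SmoothTorus

variable {p : ℕ}

instance : IsTopologicalAddGroup (SmoothTorus p) := isTopologicalAddGroup p

/-- The Fourier series of a smooth function converges unconditionally in the space of smooth
functions. -/
theorem hasSum_coeff_smul_character (h : SmoothTorus p) :
    HasSum (fun m => coeff m h • character m) h := by
  rw [← (isInducing_allWeightedCoeff p).hasSum_iff, Pi.hasSum]
  intro N
  change HasSum (fun m => weightedCoeff p N (coeff m h • character m)) (weightedCoeff p N h)
  have hs : Summable fun m => weightedCoeff p N (coeff m h • character m) := by
    refine Summable.of_norm_bounded (h.rapidDecay_coeff.summable N) fun m =>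
      norm_weightedCoeff_le fun n => ?_
    rw [map_smul, coeff_character, smul_eq_mul]
    split_ifs with hn
    · rw [hn, mul_one, mul_comm]
    · rw [mul_zero, norm_zero, mul_zero]
      exact mul_nonneg (norm_nonneg _) (pow_nonneg (freqWeight_pos m).le _)
  have e : ∑' m, weightedCoeff p N (coeff m h • character m) = weightedCoeff p N h := by
    ext n
    have h1 := (lp.evalCLM ℂ (fun _ : Fin p → ℤ => ℂ) ⊤ n).hasSum hs.hasSum
    refine h1.unique ?_
    have h2 : ∀ m, (lp.evalCLM ℂ (fun _ : Fin p → ℤ => ℂ) ⊤ n)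
        (weightedCoeff p N (coeff m h • character m)) =
          if m = n then weightedCoeff p N h n else 0 := fun m => by
      change weightedCoeff p N (coeff m h • character m) n = _
      rw [weightedCoeff_apply, weightedCoeff_apply, map_smul, coeff_character, smul_eq_mul]
      by_cases hn : m = n
      · simp [hn]
      · simp [hn, Ne.symm hn]
    simp only [h2]
    exact hasSum_ite_eq n _
  rw [← e]
  exact hs.hasSum

/-- An absolutely bounded series of linear forms defines a continuous linear form. -/
theorem exists_hasSum_continuousLinearMap {ι : Type*} (f : ι → SmoothTorus p →ₗ[ℂ] ℂ) (N : ℕ)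
    {r : ι → ℝ} (hr : Summable r) (hf : ∀ i h, ‖f i h‖ ≤ r i * ‖weightedCoeff p N h‖) :
    ∃ Φ : SmoothTorus p →L[ℂ] ℂ, ∀ h, HasSum (fun i => f i h) (Φ h) := by
  have hs : ∀ h, Summable fun i => f i h := fun h =>
    Summable.of_norm_bounded (hr.mul_right _) fun i => hf i h
  let Φ : SmoothTorus p →ₗ[ℂ] ℂ :=
    { toFun := fun h => ∑' i, f i h
      map_add' := fun g h => by
        simp only [map_add]
        exact (hs g).tsum_add (hs h)
      map_smul' := fun c h => by
        simp only [map_smul, smul_eq_mul]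
        exact tsum_mul_left }
  refine ⟨⟨Φ, LinearMap.continuous_of_norm_le (continuous_weightedCoeff p N) Φ (∑' i, r i) fun h => ?_⟩,
    fun h => (hs h).hasSum⟩
  rw [← tsum_mul_right]
  exact tsum_of_norm_bounded (hr.mul_right _).hasSum fun i => hf i h

variable (A : Matrix.GeneralLinearGroup (Fin p) ℤ) (b : Fin p → ℝ)

/-- The linear form `h ↦ (h ∘ γ ^ k)^ (m)`. -/
noncomputable def orbitCoeff (m : Fin p → ℤ) (k : ℤ) : SmoothTorus p →ₗ[ℂ] ℂ where
  toFun h := mFourierCoeff (h ∘ (torusAffine A b ^ k)) m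
  map_add' f g := mFourierCoeff_add (f.continuous.comp (continuous_torusAffine_zpow A b k))
    (g.continuous.comp (continuous_torusAffine_zpow A b k)) m
  map_smul' c f := mFourierCoeff_smul c (f ∘ (torusAffine A b ^ k)) m

theorem orbitCoeff_apply (m : Fin p → ℤ) (k : ℤ) (h : SmoothTorus p) :
    orbitCoeff A b m k h = mFourierCoeff (h ∘ (torusAffine A b ^ k)) m := rfl

theorem orbitCoeff_zero (m : Fin p → ℤ) (h : SmoothTorus p) :
    orbitCoeff A b m 0 h = coeff m h := rfl

theorem norm_orbitCoeff (m : Fin p → ℤ) (k : ℤ) (h : SmoothTorus p) :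
    ‖orbitCoeff A b m k h‖ = ‖coeff ((dualPerm A ^ k) m) h‖ :=
  norm_mFourierCoeff_comp_torusAffine_zpow A b h k m

theorem norm_pow_mul_norm_orbitCoeff_le (N : ℕ) {m : Fin p → ℤ} (hm : m ≠ 0) (k : ℤ)
    (h : SmoothTorus p) :
    ‖(dualPerm A ^ k) m‖ ^ N * ‖orbitCoeff A b m k h‖ ≤ ‖weightedCoeff p N h‖ := by
  rw [norm_orbitCoeff, ← freqWeight_of_ne_zero (dualPerm_zpow_ne_zero A k hm)]
  exact freqWeight_pow_mul_norm_coeff_le_norm N h _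

theorem orbitCoeff_compAffine (m : Fin p → ℤ) (k : ℤ) (h : SmoothTorus p) :
    orbitCoeff A b m k (compAffine A b h) = orbitCoeff A b m (k + 1) h := by
  rw [orbitCoeff_apply, orbitCoeff_apply, add_comm k, zpow_one_add]
  rfl

/-- Shifting k amounts to passing from m to σm with a phase; this is what makes the half-orbit sums
telescope. -/
theorem orbitCoeff_add_one (m : Fin p → ℤ) (k : ℤ) (h : SmoothTorus p) :
    orbitCoeff A b m (k + 1) h =
      mFourier (dualPerm A m) (torusProj p b) * orbitCoeff A b (dualPerm A m) k h := by
  rw [orbitCoeff_apply, orbitCoeff_apply, ← mFourierCoeff_comp_torusAffine, zpow_add_one]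
  rfl

theorem coeff_compAffine (m : Fin p → ℤ) (h : SmoothTorus p) : coeff m (compAffine A b h) =
    mFourier (dualPerm A m) (torusProj p b) * coeff (dualPerm A m) h :=
  mFourierCoeff_comp_torusAffine A b h m

theorem coeff_zero_compAffine (h : SmoothTorus p) : coeff 0 (compAffine A b h) = coeff 0 h := by
  have h0 : dualPerm A 0 = 0 := by simpa using dualPerm_zpow_zero A 1
  rw [coeff_compAffine, h0, mFourier_zero, ContinuousMap.one_apply, one_mul]

/-- Growth of the orbit is converted into decay of coefficients. The exponent is N + 1 so that at
least one factor ρⁿ survives, even for N = 0. -/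
theorem norm_orbitCoeff_le_of_le {K ρ M : ℝ} {N n : ℕ} {m : Fin p → ℤ} (hm : m ≠ 0) {k : ℤ}
    (hM : 0 ≤ M) (hK : 0 ≤ K) (hρ0 : 0 ≤ ρ) (hρ : ρ ≤ 1)
    (h : M ≤ K * ρ ^ n * ‖(dualPerm A ^ k) m‖) (g : SmoothTorus p) :
    M ^ (N + 1) * ‖orbitCoeff A b m k g‖ ≤ K ^ (N + 1) * ‖weightedCoeff p (N + 1) g‖ * ρ ^ n := by
  calc M ^ (N + 1) * ‖orbitCoeff A b m k g‖
      ≤ (K * ρ ^ n * ‖(dualPerm A ^ k) m‖) ^ (N + 1) * ‖orbitCoeff A b m k g‖ := by gcongr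
    _ = K ^ (N + 1) * (ρ ^ n) ^ (N + 1) *
        (‖(dualPerm A ^ k) m‖ ^ (N + 1) * ‖orbitCoeff A b m k g‖) := by ring
    _ ≤ K ^ (N + 1) * ρ ^ n * ‖weightedCoeff p (N + 1) g‖ := by
      gcongr
      · exact pow_le_of_le_one (by positivity) (pow_le_one₀ hρ0 hρ) N.succ_ne_zero
      · exact norm_pow_mul_norm_orbitCoeff_le A b (N + 1) hm k g
    _ = _ := by ring

variable {A}

/-- The stable part controls forward times and the unstable part backward times. The constant
involves 1/s(m) and 1/u(m): enough for convergence at fixed m, but not uniform in m. -/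
theorem exists_norm_orbitCoeff_le (hA : IsHyperbolic A) {m : Fin p → ℤ} (hm : m ≠ 0) :
    ∃ C ρ : ℝ, 0 < ρ ∧ ρ < 1 ∧ ∀ (h : SmoothTorus p) (n : ℕ),
      ‖orbitCoeff A b m n h‖ ≤ C * ρ ^ n * ‖weightedCoeff p 1 h‖ ∧
        ‖orbitCoeff A b m (-n) h‖ ≤ C * ρ ^ n * ‖weightedCoeff p 1 h‖ := by
  obtain ⟨s, u, K, ρ, hK, hρ0, hρ, -, hpos, hs, hu⟩ := exists_dualPerm_splitting A hA
  obtain ⟨hs0, hu0⟩ := hpos m hm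
  have key : ∀ (M : ℝ), 0 < M → ∀ (h : SmoothTorus p) (n : ℕ) (k : ℤ),
      M ≤ K * ρ ^ n * ‖(dualPerm A ^ k) m‖ →
        ‖orbitCoeff A b m k h‖ ≤ K / M * ρ ^ n * ‖weightedCoeff p 1 h‖ := by
    intro M hM h n k hk
    have := norm_orbitCoeff_le_of_le A b (N := 0) hm hM.le hK.le hρ0.le hρ.le hk h
    rw [zero_add, pow_one, pow_one] at this
    calc ‖orbitCoeff A b m k h‖ = M * ‖orbitCoeff A b m k h‖ / M := by field_simp
      _ ≤ K * ‖weightedCoeff p 1 h‖ * ρ ^ n / M := by gcongr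
      _ = _ := by ring
  refine ⟨K / s m + K / u m, ρ, hρ0, hρ, fun h n => ⟨?_, ?_⟩⟩
  · refine (key (s m) hs0 h n n (by simpa using hs m n)).trans ?_
    gcongr
    exact le_add_of_nonneg_right (by positivity)
  · refine (key (u m) hu0 h n (-n) (by simpa using hu m n)).trans ?_
    gcongr
    exact le_add_of_nonneg_left (by positivity)

theorem exists_hasSum_orbitCoeff_nat (hA : IsHyperbolic A) {m : Fin p → ℤ} (hm : m ≠ 0) :
    ∃ Φ : SmoothTorus p →L[ℂ] ℂ, ∀ h, HasSum (fun k : ℕ => orbitCoeff A b m k h) (Φ h) := by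
  obtain ⟨C, ρ, hρ0, hρ, h⟩ := exists_norm_orbitCoeff_le b hA hm
  exact exists_hasSum_continuousLinearMap (fun k : ℕ => orbitCoeff A b m k) 1
    ((summable_geometric_of_lt_one hρ0.le hρ).mul_left C) fun k g => (h g k).1

theorem exists_hasSum_orbitCoeff_int (hA : IsHyperbolic A) {m : Fin p → ℤ} (hm : m ≠ 0) :
    ∃ Φ : SmoothTorus p →L[ℂ] ℂ, ∀ h, HasSum (fun k : ℤ => orbitCoeff A b m k h) (Φ h) := by
  obtain ⟨C, ρ, hρ0, hρ, h⟩ := exists_norm_orbitCoeff_le b hA hm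
  have hs := (summable_geometric_of_lt_one hρ0.le hρ).mul_left C
  refine exists_hasSum_continuousLinearMap (fun k : ℤ => orbitCoeff A b m k) 1
    (r := fun k => C * ρ ^ k.natAbs) (Summable.of_nat_of_neg (by simpa using hs)
      (by simpa using hs)) fun k g => ?_
  obtain ⟨n, rfl | rfl⟩ := k.eq_nat_or_neg
  · simpa using (h g n).1
  · simpa using (h g n).2

/-- The half-orbit sums of a function whose full orbit sums vanish decay rapidly. -/
theorem exists_freqWeight_pow_mul_norm_le (hA : IsHyperbolic A) (N : ℕ) :
    ∃ C : ℝ, 0 ≤ C ∧ ∀ (m : Fin p → ℤ), m ≠ 0 → ∀ (g : SmoothTorus p) (a : ℂ),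
      HasSum (fun k : ℕ => orbitCoeff A b m k g) a →
      HasSum (fun k : ℤ => orbitCoeff A b m k g) 0 →
      freqWeight m ^ N * ‖a‖ ≤ C * ‖weightedCoeff p (N + 1) g‖ := by
  obtain ⟨s, u, K, ρ, hK, hρ0, hρ, hsu, -, hs, hu⟩ := exists_dualPerm_splitting A hA
  -- The 2 comes from ‖m‖ ≤ 2 max(s, u), and (1 − ρ)⁻¹ sums the geometric series.
  refine ⟨(2 * K) ^ (N + 1) * (1 - ρ)⁻¹, mul_nonneg (by positivity)
    (inv_nonneg.2 (sub_nonneg.2 hρ.le)), fun m hm g a ha h0 => ?_⟩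
  have key : ∀ (f : ℕ → ℤ) (e : ℂ), HasSum (fun n => orbitCoeff A b m (f n) g) e →
      (∀ n, ‖m‖ ≤ 2 * K * ρ ^ n * ‖(dualPerm A ^ f n) m‖) →
      freqWeight m ^ N * ‖e‖ ≤ (2 * K) ^ (N + 1) * (1 - ρ)⁻¹ * ‖weightedCoeff p (N + 1) g‖ := by
    intro f e he hf
    have hgeo := (hasSum_geometric_of_lt_one hρ0.le hρ).mul_left
      ((2 * K) ^ (N + 1) * ‖weightedCoeff p (N + 1) g‖)
    have hle : ‖((‖m‖ ^ (N + 1) : ℝ) : ℂ) * e‖ ≤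
        (2 * K) ^ (N + 1) * ‖weightedCoeff p (N + 1) g‖ * (1 - ρ)⁻¹ := by
      rw [← (he.mul_left ((‖m‖ ^ (N + 1) : ℝ) : ℂ)).tsum_eq]
      refine tsum_of_norm_bounded hgeo fun n => ?_
      rw [norm_mul, Complex.norm_real, Real.norm_of_nonneg (by positivity)]
      exact norm_orbitCoeff_le_of_le A b hm (norm_nonneg m) (by positivity) hρ0.le hρ.le (hf n) g
    rw [norm_mul, Complex.norm_real, Real.norm_of_nonneg (by positivity)] at hle
    calc freqWeight m ^ N * ‖e‖ ≤ ‖m‖ ^ (N + 1) * ‖e‖ := by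
          rw [freqWeight_of_ne_zero hm]
          gcongr
          · exact one_le_norm_of_ne_zero hm
          · exact N.le_succ
      _ ≤ _ := hle
      _ = _ := by ring
  -- Sum along the direction whose component dominates m; only the backward case needs the full sum
  -- to vanish.
  rcases le_total (u m) (s m) with hc | hc
  · refine key (fun n => n) a ha fun n => ?_
    have h1 := hs m n
    rw [zpow_natCast]
    linarith [hsu m]
  -- The complementary half-orbit starts at k = −1, since k = 0 belongs to the forward sum.
  · have hneg : HasSum (fun n : ℕ => orbitCoeff A b m (-((n : ℤ) + 1)) g) (-a) := by
      have hsum := h0.summable.comp_injective (i := fun n : ℕ => -((n : ℤ) + 1))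
        fun x y hxy => by
          have : -((x : ℤ) + 1) = -((y : ℤ) + 1) := hxy
          lia
      have h1 := HasSum.of_nat_of_neg_add_one (f := fun k => orbitCoeff A b m k g) ha hsum.hasSum
      have h2 := h1.unique h0
      rw [← eq_neg_of_add_eq_zero_right h2]
      exact hsum.hasSum
    rw [← norm_neg]
    refine key (fun n => -((n : ℤ) + 1)) (-a) hneg fun n => ?_
    have h1 := hu m (n + 1)
    have e : dualPerm A ^ (-((n : ℤ) + 1)) = (dualPerm A)⁻¹ ^ (n + 1) := by
      rw [zpow_neg, inv_pow, ← zpow_natCast]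
      push_cast
      rfl
    have h2 : K * ρ ^ (n + 1) * ‖((dualPerm A)⁻¹ ^ (n + 1)) m‖ ≤
        K * ρ ^ n * ‖((dualPerm A)⁻¹ ^ (n + 1)) m‖ := by
      gcongr ?_ * ?_ * ?_
      exact pow_le_pow_of_le_one hρ0.le hρ.le n.le_succ
    rw [e]
    linarith [hsu m]

end SmoothTorus

end Frechet

/-! ### Invariant forms and the cohomological equation. -/

namespace SmoothTorus

variable {p : ℕ} {A : Matrix.GeneralLinearGroup (Fin p) ℤ}

theorem exists_invariant_forms (hA : IsHyperbolic A) (b : Fin p → ℝ) :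
    ∃ Φ : (Fin p → ℤ) → (SmoothTorus p →L[ℂ] ℂ), (∀ h, Φ 0 h = coeff 0 h) ∧
      (∀ m, m ≠ 0 → ∀ h, HasSum (fun k : ℤ => orbitCoeff A b m k h) (Φ m h)) ∧
      ∀ m h, Φ m (compAffine A b h) = Φ m h := by
  classical
  have hcoeff : Continuous (coeff (p := p) 0) :=
    LinearMap.continuous_of_norm_le (continuous_weightedCoeff p 0) _ 1 fun h => by
      simpa using freqWeight_pow_mul_norm_coeff_le_norm 0 h 0
  choose Φ hΦ using fun m : {m : Fin p → ℤ // m ≠ 0} => exists_hasSum_orbitCoeff_int b hA m.2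
  refine ⟨fun m => if hm : m = 0 then ⟨coeff 0, hcoeff⟩ else Φ ⟨m, hm⟩, fun h => ?_,
    fun m hm h => ?_, fun m h => ?_⟩
  · beta_reduce
    rw [dif_pos rfl]
    rfl
  · beta_reduce
    rw [dif_neg hm]
    exact hΦ ⟨m, hm⟩ h
  · beta_reduce
    by_cases hm : m = 0
    · rw [dif_pos hm]
      exact coeff_zero_compAffine A b h
    · rw [dif_neg hm]
      have h1 := hΦ ⟨m, hm⟩ (compAffine A b h)
      simp only [orbitCoeff_compAffine] at h1
      -- Composing with γ shifts k by one, which a sum over all of ℤ does not see.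
      exact h1.unique ((Equiv.addRight (1 : ℤ)).hasSum_iff.2 (hΦ ⟨m, hm⟩ h))

theorem apply_eq_zero_of_mem_range_coboundary {b : Fin p → ℝ} {Φ : SmoothTorus p →L[ℂ] ℂ}
    (hΦ : ∀ h, Φ (compAffine A b h) = Φ h) {g : SmoothTorus p}
    (hg : g ∈ LinearMap.range (coboundary A b)) : Φ g = 0 := by
  obtain ⟨h, rfl⟩ := hg
  change Φ (h - compAffine A b h) = 0
  rw [map_sub, hΦ, sub_self]

/-- At m ≠ 0 the coefficient of H − H ∘ γ is the sum over k ≥ 0 minus the sum over k ≥ 1, leaving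
ĝ(m). At m = 0 it vanishes for any H, so g must have mean zero. -/
theorem coboundary_eq_of_coeff {b : Fin p → ℝ} {g H : SmoothTorus p} (hg : coeff 0 g = 0)
    (hH : ∀ m, m ≠ 0 → HasSum (fun k : ℕ => orbitCoeff A b m k g) (coeff m H)) :
    coboundary A b H = g := by
  refine ext_coeff fun m => ?_
  change coeff m (H - compAffine A b H) = _
  rw [map_sub]
  by_cases hm : m = 0
  · rw [hm, coeff_zero_compAffine, sub_self, hg]
  · have hσ : dualPerm A m ≠ 0 := by simpa using dualPerm_zpow_ne_zero A 1 hm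
    have h1 := (hasSum_nat_add_iff' 1).2 (hH m hm)
    have h2 := (hH _ hσ).mul_left (mFourier (dualPerm A m) (torusProj p b))
    simp only [← orbitCoeff_add_one] at h2
    simp only [Nat.cast_add, Nat.cast_one, Finset.sum_range_one, Nat.cast_zero,
      orbitCoeff_zero] at h1
    rw [coeff_compAffine, ← h1.unique h2, sub_sub_cancel]

/-- Fourier synthesis of a linear family of rapidly decreasing coefficients. -/
noncomputable def synthesis {V : Type*} [AddCommGroup V] [Module ℂ V] (c : V →ₗ[ℂ] (Fin p → ℤ) → ℂ)
    (hc : ∀ v, RapidDecay (c v)) : V →ₗ[ℂ] SmoothTorus p where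
  toFun v := ofCoeff (c v) (hc v)
  map_add' v w := ext_coeff fun m => by simp only [map_add, coeff_ofCoeff, Pi.add_apply]
  map_smul' z v := ext_coeff fun m => by
    simp only [map_smul, coeff_ofCoeff, Pi.smul_apply, RingHom.id_apply]

theorem coeff_synthesis {V : Type*} [AddCommGroup V] [Module ℂ V]
    (c : V →ₗ[ℂ] (Fin p → ℤ) → ℂ) (hc : ∀ v, RapidDecay (c v)) (v : V) (m : Fin p → ℤ) :
    coeff m (synthesis c hc v) = c v m :=
  coeff_ofCoeff (c v) (hc v) m

theorem continuous_iff_weightedCoeff {X : Type*} [TopologicalSpace X] {f : X → SmoothTorus p} :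
    Continuous f ↔ ∀ N, Continuous fun x => weightedCoeff p N (f x) := by
  rw [(isInducing_allWeightedCoeff p).continuous_iff, continuous_pi_iff]
  rfl

/-- On a space of functions with vanishing orbit sums, the half-orbit sums are the Fourier
coefficients of a solution of the cohomological equation, which depends continuously on the data. -/
theorem exists_continuous_section (hA : IsHyperbolic A) {b : Fin p → ℝ}
    {Φp : (Fin p → ℤ) → SmoothTorus p →L[ℂ] ℂ}
    (hΦp : ∀ m, m ≠ 0 → ∀ h, HasSum (fun k : ℕ => orbitCoeff A b m k h) (Φp m h))
    (V : Submodule ℂ (SmoothTorus p)) (hV0 : ∀ g ∈ V, coeff 0 g = 0)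
    (hV : ∀ g ∈ V, ∀ m, m ≠ 0 → HasSum (fun k : ℤ => orbitCoeff A b m k g) 0) :
    ∃ L : V →L[ℂ] SmoothTorus p, (∀ g, coboundary A b (L g) = g) ∧
      ∀ g : V, HasSum (fun m : {m : Fin p → ℤ // m ≠ 0} =>
        Φp m (g : SmoothTorus p) • character (m : Fin p → ℤ)) (L g) := by
  classical
  -- Constants lie in the kernel of δ, so the zero mode is free; choosing 0 matches the series over
  -- m ≠ 0.
  let c : V →ₗ[ℂ] (Fin p → ℤ) → ℂ := LinearMap.pi fun m =>
    if m = 0 then 0 else (Φp m : SmoothTorus p →ₗ[ℂ] ℂ) ∘ₗ V.subtype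
  have hc0 : ∀ g, c g 0 = 0 := fun g => by simp [c]
  have hcm : ∀ g : V, ∀ m, m ≠ 0 → c g m = Φp m g := fun g m hm => by simp [c, hm]
  have hbound : ∀ N, ∃ C, ∀ (g : V) m,
      freqWeight m ^ N * ‖c g m‖ ≤ C * ‖weightedCoeff p (N + 1) (g : SmoothTorus p)‖ := by
    intro N
    obtain ⟨C, hC0, hC⟩ := exists_freqWeight_pow_mul_norm_le b hA N
    refine ⟨C, fun g m => ?_⟩
    by_cases hm : m = 0
    · rw [hm, hc0, norm_zero, mul_zero]
      positivity
    · rw [hcm g m hm]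
      exact hC m hm g _ (hΦp m hm g) (hV g g.2 m hm)
  have hc : ∀ g, RapidDecay (c g) := fun g N => by
    obtain ⟨C, hC⟩ := hbound N
    exact ⟨_, hC g⟩
  have hcont : Continuous (synthesis c hc) := by
    rw [continuous_iff_weightedCoeff]
    intro N
    obtain ⟨C, hC⟩ := hbound N
    refine LinearMap.continuous_of_norm_le (J := weightedCoeff p (N + 1) ∘ₗ V.subtype)
      ((continuous_weightedCoeff p (N + 1)).comp continuous_subtype_val)
      (weightedCoeff p N ∘ₗ synthesis c hc) C fun g => norm_weightedCoeff_le fun m => ?_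
    rw [coeff_synthesis]
    exact hC g m
  refine ⟨⟨synthesis c hc, hcont⟩, fun g => ?_, fun g => ?_⟩
  · refine coboundary_eq_of_coeff (hV0 g g.2) fun m hm => ?_
    change HasSum _ (coeff m (synthesis c hc g))
    rw [coeff_synthesis, hcm g m hm]
    exact hΦp m hm g
  · have h := hasSum_coeff_smul_character (synthesis c hc g)
    simp only [coeff_synthesis] at h
    rw [← hasSum_subtype_iff_of_support_subset (s := {m | m ≠ 0})] at h
    · refine h.congr_fun fun m => ?_
      rw [Function.comp_apply, hcm g m m.2]
    · intro m hm h0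
      refine hm ?_
      beta_reduce
      rw [h0, hc0, zero_smul]

end SmoothTorus

theorem mainTheorem1 (p : ℕ) (A : Matrix.GeneralLinearGroup (Fin p) ℤ) (hA : IsHyperbolic A)
    (b : Fin p → ℝ) :
    -- (i)
    (IsFrechetSpace (SmoothTorus p) ∧
      IsClosed (LinearMap.range (SmoothTorus.coboundary A b) : Set (SmoothTorus p)) ∧
      (∃ Φ : (Fin p → ℤ) → (SmoothTorus p →L[ℂ] ℂ),
        (∀ h : SmoothTorus p, Φ 0 h = ∫ x, h x) ∧
        (∀ m : Fin p → ℤ, m ≠ 0 → ∀ h : SmoothTorus p,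
          HasSum (fun k : ℤ => mFourierCoeff (h ∘ (torusAffine A b ^ k)) m) (Φ m h)) ∧
        (∀ (m : Fin p → ℤ) (h : SmoothTorus p),
          Φ m (SmoothTorus.compAffine A b h) = Φ m h) ∧
        (∀ g : SmoothTorus p,
          g ∈ LinearMap.range (SmoothTorus.coboundary A b) ↔ ∀ m : Fin p → ℤ, Φ m g = 0)) ∧
      IsFrechetSpace (SmoothTorus.H1 A b) ∧
      Nontrivial (SmoothTorus.H1 A b)) ∧
    -- (ii)
    (∃ Φp : (Fin p → ℤ) → (SmoothTorus p →L[ℂ] ℂ),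
      (∀ m : Fin p → ℤ, m ≠ 0 → ∀ h : SmoothTorus p,
        HasSum (fun k : ℕ => mFourierCoeff (h ∘ (torusAffine A b ^ k)) m) (Φp m h)) ∧
      ∃ L : LinearMap.range (SmoothTorus.coboundary A b) →L[ℂ] SmoothTorus p,
        (∀ g : LinearMap.range (SmoothTorus.coboundary A b),
          SmoothTorus.coboundary A b (L g) = g) ∧
        (∀ g : LinearMap.range (SmoothTorus.coboundary A b),
          HasSum (fun m : {m : Fin p → ℤ // m ≠ 0} =>
            Φp m (g : SmoothTorus p) • SmoothTorus.character (m : Fin p → ℤ)) (L g))) := by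
  obtain ⟨Φ, hΦ0, hΦ, hΦinv⟩ := SmoothTorus.exists_invariant_forms hA b
  have hplus : ∀ m, ∃ Ψ : SmoothTorus p →L[ℂ] ℂ, m ≠ 0 → ∀ h,
      HasSum (fun k : ℕ => SmoothTorus.orbitCoeff A b m k h) (Ψ h) := fun m => by
    by_cases hm : m = 0
    · exact ⟨0, fun h => absurd hm h⟩
    · obtain ⟨Ψ, hΨ⟩ := SmoothTorus.exists_hasSum_orbitCoeff_nat b hA hm
      exact ⟨Ψ, fun _ => hΨ⟩
  choose Φp hΦp using hplus
  have hrange : ∀ g, g ∈ LinearMap.range (SmoothTorus.coboundary A b) ↔ ∀ m, Φ m g = 0 := by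
    intro g
    refine ⟨fun hg m => SmoothTorus.apply_eq_zero_of_mem_range_coboundary (hΦinv m) hg,
      fun hg => ?_⟩
    -- Applied to the common kernel of the Φ_m, the section shows that this kernel lies in the image
    -- of δ. It is applied again below, to the image itself, to obtain L.
    obtain ⟨L, hL, -⟩ := SmoothTorus.exists_continuous_section hA hΦp
      (⨅ m, LinearMap.ker (Φ m : SmoothTorus p →ₗ[ℂ] ℂ))
      (fun g hg => by
        rw [← hΦ0]
        exact Submodule.mem_iInf _ |>.1 hg 0)
      (fun g hg m hm => by
        rw [← show Φ m g = 0 from Submodule.mem_iInf _ |>.1 hg m]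
        exact hΦ m hm g)
    exact ⟨L ⟨g, (Submodule.mem_iInf _).2 hg⟩, hL _⟩
  have hclosed : IsClosed (LinearMap.range (SmoothTorus.coboundary A b) : Set (SmoothTorus p)) := by
    have e : (LinearMap.range (SmoothTorus.coboundary A b) : Set (SmoothTorus p)) =
        ⋂ m, {g | Φ m g = 0} := by
      ext g
      rw [SetLike.mem_coe, hrange, Set.mem_iInter]
      rfl
    rw [e]
    exact isClosed_iInter fun m => isClosed_eq (Φ m).continuous continuous_const
  refine ⟨⟨SmoothTorus.isFrechetSpace p, hclosed, ⟨Φ, fun h => ?_, hΦ, hΦinv, hrange⟩,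
    (SmoothTorus.isFrechetSpace p).quotient _ hclosed, ?_⟩, Φp, fun m hm h => ?_, ?_⟩
  · rw [hΦ0]
    exact mFourierCoeff_zero_eq_integral h
  · rw [Submodule.Quotient.nontrivial_iff]
    intro htop
    -- The constant function 1 has mean 1, so it is not a coboundary.
    have h1 := (hrange (SmoothTorus.character 0)).1 (htop ▸ Submodule.mem_top) 0
    rw [hΦ0, SmoothTorus.coeff_character, if_pos rfl] at h1
    exact one_ne_zero h1
  · simpa only [SmoothTorus.orbitCoeff_apply, zpow_natCast] using hΦp m hm h
  · refine SmoothTorus.exists_continuous_section hA hΦp _ (fun g hg => ?_) fun g hg m hm => ?_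
    · rw [← hΦ0]
      exact (hrange g).1 hg 0
    · rw [← (hrange g).1 hg m]
      exact hΦ m hm g
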